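/- For a tuple $N=(n_1,\dots,n_k)$ of positive integers let $L$ be the lattice of all $x\in\mathbb N^k$ with $1\le x_i\le n_i$ for all $i$, ordered componentwise by $\preceq$, and let $n=\max_i n_i$. The search problem Tarski is: given $L$ and a function $f:L\to L$ (not necessarily order preserving), find either a point $x\in L$ with $f(x)=x$, or two points $x,y\in L$ with $x\preceq y$ and $f(x)\not\preceq f(y)$. The side lengths are given in binary, and $f$ is presented as a Boolean circuit (gates of fan-in at most two) that maps the binary notation of each $x\in L$ to that of $f(x)$; the size of the circuit is its number of gates. **Theorem.** There is one deterministic algorithm for Tarski such that for every polynomial $p$ in two variables there is a polynomial $q$ in two variables with the following property. For all $k\ge 3$, all $n_1,\dots,n_k\ge 1$ with $n\ge 2$, and every $f:L\to L$ that is presented as a Boolean circuit of size at most $p(\log_2 n,k)$, the algorithm finds a solution in time at most $$q(\log_2 n,k)\cdot(\log_2 n)^{k-1}.$$ Time is the number of elementary steps of a program in first-order pure Lisp: the data are binary trees, and each reading of a variable, nil, cons, head, tail, test for nil, binding or function call costs one step. -/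

import Mathlib

namespace TarskiTime

/-! ### The grid and the search problem -/

/-- The lattice of all points `x` with `1 ≤ x i ≤ N i` for every coordinate `i`; as a subtype of
`Fin k → ℕ` it carries the componentwise order. -/
def Grid {k : ℕ} (N : Fin k → ℕ) : Set (Fin k → ℕ) :=
  {x | ∀ i, 1 ≤ x i ∧ x i ≤ N i}

/-- The largest side length of the grid. -/
def width {k : ℕ} (N : Fin k → ℕ) : ℕ := Finset.univ.sup N

/-- What an algorithm for the search problem may answer. -/
inductive Answer (L : Type) where
  | fixedPoint (x : L)
  | violation (x y : L)

/-- The correct answers: a fixed point of `f`, or two points that witness that `f` is not order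
preserving. -/
def Answer.IsSolution {L : Type} [LE L] (f : L → L) : Answer L → Prop
  | .fixedPoint x => f x = x
  | .violation x y => x ≤ y ∧ ¬ f x ≤ f y

/-! ### Boolean circuits -/

/-- A gate of fan-in at most two; its inputs are given by the numbers of the wires it reads. -/
inductive Gate where
  | const (b : Bool)
  | not (i : ℕ)
  | and (i j : ℕ)
  | or (i j : ℕ)

/-- The wires that a gate reads. -/
def Gate.inputs : Gate → List ℕ
  | .const _ => []
  | .not i => [i]
  | .and i j => [i, j]
  | .or i j => [i, j]

/-- The value of a gate, from the values of the wires so far. -/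
def Gate.eval (vals : List Bool) : Gate → Bool
  | .const b => b
  | .not i => !(vals.getD i false)
  | .and i j => vals.getD i false && vals.getD j false
  | .or i j => vals.getD i false || vals.getD j false

/-- A Boolean circuit with `m` inputs and `l` outputs. The gates are listed in topological order:
wires `0, …, m - 1` are the inputs, and wire `m + i` is the output of gate number `i`, which may
only read wires with smaller numbers. -/
structure Circuit (m l : ℕ) where
  gates : List Gate
  outputs : List ℕ
  gates_lt : ∀ (i : ℕ) (h : i < gates.length), ∀ w ∈ (gates[i]).inputs, w < m + i
  outputs_lt : ∀ w ∈ outputs, w < m + gates.length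
  length_outputs : outputs.length = l

/-- The size of a circuit is the number of its gates. -/
def Circuit.size {m l : ℕ} (C : Circuit m l) : ℕ := C.gates.length

/-- The values of all wires of a circuit on an input. -/
def Circuit.wires {m l : ℕ} (C : Circuit m l) (input : List Bool) : List Bool :=
  C.gates.foldl (fun vals g => vals ++ [g.eval vals]) input

/-- The output of a circuit on an input. -/
def Circuit.eval {m l : ℕ} (C : Circuit m l) (input : List Bool) : List Bool :=
  C.outputs.map fun w => (C.wires input).getD w false

/-! ### Points as bit strings, and functions given by circuits -/

/-- The number of bits of a coordinate: the length of the binary notation of the width. -/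
def bitLength {k : ℕ} (N : Fin k → ℕ) : ℕ := Nat.size (width N)

/-- The `b` lowest binary digits of `x`, the least significant one first. -/
def bits (b x : ℕ) : List Bool := (List.range b).map fun j => x.testBit j

/-- A point of the grid as the list of its coordinates in binary. -/
def pointBits {k : ℕ} (N : Fin k → ℕ) (x : Fin k → ℕ) : List (List Bool) :=
  List.ofFn fun i => bits (bitLength N) (x i)

/-- The circuit `C` computes the function `f` on the grid. (Nothing is asked of `C` on bit strings
that are not points of the grid.) -/
def Circuit.Presents {k : ℕ} {N : Fin k → ℕ}
    (C : Circuit (k * bitLength N) (k * bitLength N)) (f : Grid N → Grid N) : Prop :=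
  ∀ x : Grid N, C.eval (pointBits N x).flatten = (pointBits N (f x)).flatten

/-! ### Algorithms and running time

The model is first-order pure Lisp: all data are binary trees built from `nil` by `cons`, and a
program is a finite list of mutually recursive functions. Every elementary operation (reading a
variable, `nil`, `cons`, `head`, `tail`, a test for `nil`, a binding, a call) costs one step and
works on a bounded number of cells. There is no primitive arithmetic, no comparison of trees, and no
access to an oracle. -/

/-- The data of the model. -/
inductive SExp where
  | nil
  | cons (a d : SExp)

/-- The first component of a pair. -/
def SExp.head : SExp → SExp
  | .nil => .nil
  | .cons a _ => a

/-- The second component of a pair. -/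
def SExp.tail : SExp → SExp
  | .nil => .nil
  | .cons _ d => d

/-- Expressions; `var i` is the variable that was bound `i` bindings ago (de Bruijn index). -/
inductive Expr where
  | var (i : ℕ)
  | nil
  | cons (e₁ e₂ : Expr)
  | head (e : Expr)
  | tail (e : Expr)
  | ite (c e₁ e₂ : Expr)
  | letIn (e₁ e₂ : Expr)
  | call (f : ℕ) (e : Expr)

/-- A program is the list of the bodies of its functions. Each function has one argument, which is
variable `0` of its body. Function `0` is the main function. -/
abbrev Program := List Expr

/-- `Eval P ρ e v t`: in the program `P`, with `ρ` the list of the values of the variables, the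
evaluation (call by value) of the expression `e` ends with the value `v` after exactly `t` steps. -/
inductive Eval (P : Program) : List SExp → Expr → SExp → ℕ → Prop where
  | var (ρ : List SExp) (i : ℕ) : Eval P ρ (.var i) (ρ.getD i .nil) 1
  | nil (ρ : List SExp) : Eval P ρ .nil .nil 1
  | cons {ρ : List SExp} {e₁ e₂ : Expr} {v₁ v₂ : SExp} {t₁ t₂ : ℕ} :
      Eval P ρ e₁ v₁ t₁ → Eval P ρ e₂ v₂ t₂ →
      Eval P ρ (.cons e₁ e₂) (.cons v₁ v₂) (t₁ + t₂ + 1)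
  | head {ρ : List SExp} {e : Expr} {v : SExp} {t : ℕ} :
      Eval P ρ e v t → Eval P ρ (.head e) v.head (t + 1)
  | tail {ρ : List SExp} {e : Expr} {v : SExp} {t : ℕ} :
      Eval P ρ e v t → Eval P ρ (.tail e) v.tail (t + 1)
  | ite_cons {ρ : List SExp} {c e₁ e₂ : Expr} {a d v : SExp} {s t : ℕ} :
      Eval P ρ c (.cons a d) s → Eval P ρ e₁ v t →
      Eval P ρ (.ite c e₁ e₂) v (s + t + 1)
  | ite_nil {ρ : List SExp} {c e₁ e₂ : Expr} {v : SExp} {s t : ℕ} :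
      Eval P ρ c .nil s → Eval P ρ e₂ v t →
      Eval P ρ (.ite c e₁ e₂) v (s + t + 1)
  | letIn {ρ : List SExp} {e₁ e₂ : Expr} {a v : SExp} {s t : ℕ} :
      Eval P ρ e₁ a s → Eval P (a :: ρ) e₂ v t →
      Eval P ρ (.letIn e₁ e₂) v (s + t + 1)
  | call {ρ : List SExp} {f : ℕ} {e : Expr} {a v : SExp} {s t : ℕ} :
      Eval P ρ e a s → Eval P [a] (P.getD f .nil) v t →
      Eval P ρ (.call f e) v (s + t + 1)

/-- Evaluation is deterministic: both the value and the number of steps are unique. -/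
theorem Eval.unique {P : Program} {ρ : List SExp} {e : Expr} {v v' : SExp} {t t' : ℕ}
    (h : Eval P ρ e v t) (h' : Eval P ρ e v' t') : v = v' ∧ t = t' := by
  induction h generalizing v' t' with
  | var ρ i => cases h'; exact ⟨rfl, rfl⟩
  | nil ρ => cases h'; exact ⟨rfl, rfl⟩
  | cons _ _ ih₁ ih₂ =>
    cases h' with
    | cons h₁ h₂ =>
      obtain ⟨rfl, rfl⟩ := ih₁ h₁
      obtain ⟨rfl, rfl⟩ := ih₂ h₂
      exact ⟨rfl, rfl⟩
  | head _ ih =>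
    cases h' with
    | head h₁ => obtain ⟨rfl, rfl⟩ := ih h₁; exact ⟨rfl, rfl⟩
  | tail _ ih =>
    cases h' with
    | tail h₁ => obtain ⟨rfl, rfl⟩ := ih h₁; exact ⟨rfl, rfl⟩
  | ite_cons _ _ ih₁ ih₂ =>
    cases h' with
    | ite_cons h₁ h₂ =>
      obtain ⟨_, rfl⟩ := ih₁ h₁
      obtain ⟨rfl, rfl⟩ := ih₂ h₂
      exact ⟨rfl, rfl⟩
    | ite_nil h₁ h₂ => exact absurd (ih₁ h₁).1 (by simp)
  | ite_nil _ _ ih₁ ih₂ =>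
    cases h' with
    | ite_cons h₁ h₂ => exact absurd (ih₁ h₁).1 (by simp)
    | ite_nil h₁ h₂ =>
      obtain ⟨_, rfl⟩ := ih₁ h₁
      obtain ⟨rfl, rfl⟩ := ih₂ h₂
      exact ⟨rfl, rfl⟩
  | letIn _ _ ih₁ ih₂ =>
    cases h' with
    | letIn h₁ h₂ =>
      obtain ⟨rfl, rfl⟩ := ih₁ h₁
      obtain ⟨rfl, rfl⟩ := ih₂ h₂
      exact ⟨rfl, rfl⟩
  | call _ _ ih₁ ih₂ =>
    cases h' with
    | call h₁ h₂ =>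
      obtain ⟨rfl, rfl⟩ := ih₁ h₁
      obtain ⟨rfl, rfl⟩ := ih₂ h₂
      exact ⟨rfl, rfl⟩

/-- On the input `a` the program `P` halts with the output `v` after exactly `t` steps. -/
def Program.HaltsIn (P : Program) (a v : SExp) (t : ℕ) : Prop :=
  Eval P [a] (P.getD 0 .nil) v t

/-! ### Inputs and outputs as data -/

/-- `false` is `nil`, `true` is a pair. -/
def encodeBool : Bool → SExp
  | false => .nil
  | true => .cons .nil .nil

/-- Lists, in the usual way. -/
def encodeList {α : Type} (enc : α → SExp) : List α → SExp
  | [] => .nil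
  | a :: l => .cons (enc a) (encodeList enc l)

/-- Natural numbers in unary; used only for wire numbers and tags. -/
def encodeUnary : ℕ → SExp
  | 0 => .nil
  | n + 1 => .cons .nil (encodeUnary n)

/-- A gate: its kind, followed by its arguments. -/
def encodeGate : Gate → SExp
  | .const b => .cons (encodeUnary 0) (encodeBool b)
  | .not i => .cons (encodeUnary 1) (encodeUnary i)
  | .and i j => .cons (encodeUnary 2) (.cons (encodeUnary i) (encodeUnary j))
  | .or i j => .cons (encodeUnary 3) (.cons (encodeUnary i) (encodeUnary j))

/-- A circuit: the list of its gates and the list of its output wires. -/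
def encodeCircuit {m l : ℕ} (C : Circuit m l) : SExp :=
  .cons (encodeList encodeGate C.gates) (encodeList encodeUnary C.outputs)

/-- A point: the list of its coordinates, each the list of its binary digits. -/
def encodePoint {k : ℕ} (N : Fin k → ℕ) (x : Fin k → ℕ) : SExp :=
  encodeList (encodeList encodeBool) (pointBits N x)

/-- The input of the algorithm: the side lengths of the grid, in binary, and the circuit. -/
def encodeInput {k : ℕ} (N : Fin k → ℕ)
    (C : Circuit (k * bitLength N) (k * bitLength N)) : SExp :=
  .cons (encodePoint N N) (encodeCircuit C)

/-- The output of the algorithm: the kind of the answer, followed by one or two points. -/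
def encodeAnswer {k : ℕ} {N : Fin k → ℕ} : Answer (Grid N) → SExp
  | .fixedPoint x => .cons (encodeBool false) (encodePoint N x)
  | .violation x y => .cons (encodeBool true) (.cons (encodePoint N x) (encodePoint N y))

end TarskiTime

open TarskiTime

/-! The algorithm works on boxes [lo, hi] with a mask of active coordinates, under the invariant
that lo ≤ f(lo) and f(hi) ≤ hi hold in the active coordinates. If an active coordinate j has range
at least 8, the slice at the midpoint of j is solved recursively with j made inactive. The resulting
x is fixed in the other active coordinates, so comparing x with f(x) in coordinate j alone tells
which of [x, hi] and [lo, x] inherits the invariant. If all active ranges are below 8, lo is moved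
upward by f until no active coordinate changes. Wherever preserving the invariant needs
monotonicity, the inequality is tested; a failed test is itself a legal answer (`fn_solve`).

The delicate point is the number of calls. One of the k factors log n can be absorbed into q, but a
bound like (log n + 1)^k would not suffice: for bounded n its quotient by (log n)^k is exponential
in k. Bisection therefore stops early, at ranges below 8, and the measure `rounds` stays below log n
with no additive constant, yet drops by one at each bisection (`rounds_half`). Its product over the
active coordinates, `leaves`, bounds slice plus half by the whole (`leaves_slice`); `calls` adds the
cost of climbing in small boxes, which is linear in k per leaf (`calls_slice`, `calls_climb`).

A call without its recursive calls takes polynomial time. The `fn_` lemmas match each function of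
the program with a function on trees and bound its steps; the lemmas on codes then identify these
tree functions with arithmetic, comparison and circuit evaluation. `time_le_timePoly` collects the
bounds. -/

namespace TarskiTime

/-! ### A calculus for running times -/

/-- Evaluation within a time bound. -/
def EvalLE (P : Program) (ρ : List SExp) (e : Expr) (v : SExp) (t : ℕ) : Prop :=
  ∃ s ≤ t, Eval P ρ e v s

/-- The call of function `f` on `a` has a value and a time bound that satisfy `Q`. -/
def CallSpec (P : Program) (f : ℕ) (a : SExp) (Q : SExp → ℕ → Prop) : Prop :=
  ∃ v t, EvalLE P [a] (P.getD f .nil) v t ∧ Q v t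

/-- Weakest preconditions, with calls interpreted by their specification. -/
def wp (P : Program) : List SExp → Expr → (SExp → ℕ → Prop) → Prop
  | ρ, .var i, Q => Q (ρ.getD i .nil) 1
  | _, .nil, Q => Q .nil 1
  | ρ, .cons e₁ e₂, Q => wp P ρ e₁ fun v s => wp P ρ e₂ fun w t => Q (.cons v w) (s + t + 1)
  | ρ, .head e, Q => wp P ρ e fun v s => Q v.head (s + 1)
  | ρ, .tail e, Q => wp P ρ e fun v s => Q v.tail (s + 1)
  | ρ, .ite c e₁ e₂, Q => wp P ρ c fun v s =>
      match v with
      | .nil => wp P ρ e₂ fun w t => Q w (s + t + 1)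
      | .cons _ _ => wp P ρ e₁ fun w t => Q w (s + t + 1)
  | ρ, .letIn e₁ e₂, Q => wp P ρ e₁ fun v s => wp P (v :: ρ) e₂ fun w t => Q w (s + t + 1)
  | ρ, .call f e, Q => wp P ρ e fun a s => CallSpec P f a fun w t => Q w (s + t + 1)

/-- Since `wp` never unfolds a called function, structural induction on the expression suffices.
Recursion of the program is dealt with later, by induction on the data in each specification. -/
theorem wp.sound {P : Program} {ρ : List SExp} {e : Expr} {Q : SExp → ℕ → Prop}
    (h : wp P ρ e Q) : ∃ v t, EvalLE P ρ e v t ∧ Q v t := by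
  induction e generalizing ρ Q with
  | var i => exact ⟨_, _, ⟨_, le_rfl, .var ρ i⟩, h⟩
  | nil => exact ⟨_, _, ⟨_, le_rfl, .nil ρ⟩, h⟩
  | cons e₁ e₂ ih₁ ih₂ =>
    obtain ⟨v, s, ⟨s', hs, h₁⟩, h⟩ := ih₁ h
    obtain ⟨w, t, ⟨t', ht, h₂⟩, h⟩ := ih₂ h
    exact ⟨_, _, ⟨_, by omega, .cons h₁ h₂⟩, h⟩
  | head e ih =>
    obtain ⟨v, s, ⟨s', hs, h₁⟩, h⟩ := ih h
    exact ⟨_, _, ⟨_, by omega, .head h₁⟩, h⟩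
  | tail e ih =>
    obtain ⟨v, s, ⟨s', hs, h₁⟩, h⟩ := ih h
    exact ⟨_, _, ⟨_, by omega, .tail h₁⟩, h⟩
  | ite c e₁ e₂ ihc ih₁ ih₂ =>
    obtain ⟨v, s, ⟨s', hs, h₁⟩, h⟩ := ihc h
    cases v with
    | nil =>
      obtain ⟨w, t, ⟨t', ht, h₂⟩, h⟩ := ih₂ h
      exact ⟨_, _, ⟨_, by omega, .ite_nil h₁ h₂⟩, h⟩
    | cons _ _ =>
      obtain ⟨w, t, ⟨t', ht, h₂⟩, h⟩ := ih₁ h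
      exact ⟨_, _, ⟨_, by omega, .ite_cons h₁ h₂⟩, h⟩
  | letIn e₁ e₂ ih₁ ih₂ =>
    obtain ⟨v, s, ⟨s', hs, h₁⟩, h⟩ := ih₁ h
    obtain ⟨w, t, ⟨t', ht, h₂⟩, h⟩ := ih₂ h
    exact ⟨_, _, ⟨_, by omega, .letIn h₁ h₂⟩, h⟩
  | call f e ih =>
    obtain ⟨v, s, ⟨s', hs, h₁⟩, h⟩ := ih h
    obtain ⟨w, t, ⟨t', ht, h₂⟩, h⟩ := h
    exact ⟨_, _, ⟨_, by omega, .call h₁ h₂⟩, h⟩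

theorem EvalLE.of_wp {P : Program} {ρ : List SExp} {e : Expr} {v : SExp} {t : ℕ}
    (h : wp P ρ e fun w s => w = v ∧ s ≤ t) : EvalLE P ρ e v t := by
  obtain ⟨_, s, ⟨s', hs, h'⟩, rfl, hst⟩ := h.sound
  exact ⟨s', hs.trans hst, h'⟩

theorem EvalLE.mono {P : Program} {ρ : List SExp} {e : Expr} {v : SExp} {s t : ℕ}
    (h : EvalLE P ρ e v s) (hst : s ≤ t) : EvalLE P ρ e v t := by
  obtain ⟨s', hs, h⟩ := h
  exact ⟨s', hs.trans hst, h⟩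

theorem CallSpec.intro {P : Program} {f : ℕ} {a v : SExp} {t : ℕ} {Q : SExp → ℕ → Prop}
    (h : EvalLE P [a] (P.getD f .nil) v t) (hQ : Q v t) : CallSpec P f a Q :=
  ⟨v, t, h, hQ⟩

/-! ### The program -/

namespace Prog

/-- The truth value `true`. -/
abbrev tt : Expr := .cons .nil .nil

/-- The first of several arguments. -/
abbrev fst (i : ℕ) : Expr := .head (.var i)

/-- The second and last argument. -/
abbrev snd (i : ℕ) : Expr := .tail (.var i)

/-- The second of at least three arguments. -/
abbrev mid (i : ℕ) : Expr := .head (.tail (.var i))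

/-- The third and last argument. -/
abbrev lst (i : ℕ) : Expr := .tail (.tail (.var i))

/-- Negation. -/
abbrev neg (e : Expr) : Expr := .ite e .nil tt

abbrev solveId : ℕ := 1
abbrev leId : ℕ := 2
abbrev leAllId : ℕ := 3
abbrev addId : ℕ := 4
abbrev avgAllId : ℕ := 5
abbrev selId : ℕ := 6
abbrev bigId : ℕ := 7
abbrev pickId : ℕ := 8
abbrev appId : ℕ := 9
abbrev flatId : ℕ := 10
abbrev nthId : ℕ := 11
abbrev gateId : ℕ := 12
abbrev gatesId : ℕ := 13
abbrev outsId : ℕ := 14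
abbrev takeId : ℕ := 15
abbrev dropId : ℕ := 16
abbrev shapeId : ℕ := 17
abbrev evalId : ℕ := 18
abbrev onesId : ℕ := 19

/-- Comparison of bit strings, least significant bit first; the third argument is the answer for
equal strings. -/
def le : Expr :=
  .ite (fst 0)
    (.call leId (.cons (.tail (fst 0)) (.cons (.tail (mid 0))
      (.ite (.head (fst 0))
        (.ite (.head (mid 0)) (lst 0) .nil)
        (.ite (.head (mid 0)) tt (lst 0))))))
    (lst 0)

/-- Componentwise comparison of points. -/
def leAll : Expr :=
  .ite (fst 0)
    (.ite (.call leId (.cons (.head (fst 0)) (.cons (.head (snd 0)) tt)))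
      (.call leAllId (.cons (.tail (fst 0)) (.tail (snd 0))))
      .nil)
    tt

/-- Addition with carry. -/
def add : Expr :=
  .ite (fst 0)
    (.cons
      (.ite (.head (fst 0))
        (.ite (.head (mid 0)) (lst 0) (neg (lst 0)))
        (.ite (.head (mid 0)) (neg (lst 0)) (lst 0)))
      (.call addId (.cons (.tail (fst 0)) (.cons (.tail (mid 0))
        (.ite (.head (fst 0))
          (.ite (.head (mid 0)) tt (lst 0))
          (.ite (.head (mid 0)) (lst 0) .nil))))))
    (.cons (lst 0) .nil)

/-- The average of two numbers, rounded down. -/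
abbrev avg (e₁ e₂ : Expr) : Expr := .tail (.call addId (.cons e₁ (.cons e₂ .nil)))

/-- The componentwise average of two points. -/
def avgAll : Expr :=
  .ite (fst 0)
    (.cons (avg (.head (fst 0)) (.head (snd 0)))
      (.call avgAllId (.cons (.tail (fst 0)) (.tail (snd 0)))))
    .nil

/-- Replace the marked components of a list by those of another list. -/
def sel : Expr :=
  .ite (mid 0)
    (.cons (.ite (.head (fst 0)) (.head (lst 0)) (.head (mid 0)))
      (.call selId (.cons (.tail (fst 0)) (.cons (.tail (mid 0)) (.tail (lst 0))))))
    .nil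

/-- Whether the difference of two numbers is at least eight. -/
def big : Expr :=
  .call leId (.cons (fst 0)
    (.cons (avg (fst 0) (avg (fst 0) (avg (fst 0) (snd 0)))) .nil))

/-- Mark the first component that is in the mask and has a large range. -/
def pick : Expr :=
  .ite (mid 0)
    (.ite (.ite (.head (fst 0)) (.call bigId (.cons (.head (mid 0)) (.head (lst 0)))) .nil)
      (.cons tt .nil)
      (.letIn
        (.call pickId (.cons (.tail (fst 0)) (.cons (.tail (mid 0)) (.tail (lst 0)))))
        (.ite (.var 0) (.cons .nil (.var 0)) .nil)))
    .nil

/-- Concatenation. -/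
def app : Expr :=
  .ite (fst 0) (.cons (.head (fst 0)) (.call appId (.cons (.tail (fst 0)) (snd 0)))) (snd 0)

/-- Concatenation of a list of lists. -/
def flat : Expr :=
  .ite (.var 0) (.call appId (.cons (fst 0) (.call flatId (snd 0)))) .nil

/-- Access to a list by a unary index. -/
def nth : Expr :=
  .ite (snd 0) (.call nthId (.cons (.tail (fst 0)) (.tail (snd 0)))) (.head (fst 0))

/-- The value of a gate. -/
def gate : Expr :=
  .ite (.head (fst 0))
    (.ite (.tail (.head (fst 0)))
      (.ite (.tail (.tail (.head (fst 0))))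
        (.ite (.call nthId (.cons (snd 0) (.head (.tail (fst 0)))))
          tt
          (.call nthId (.cons (snd 0) (.tail (.tail (fst 0))))))
        (.ite (.call nthId (.cons (snd 0) (.head (.tail (fst 0)))))
          (.call nthId (.cons (snd 0) (.tail (.tail (fst 0)))))
          .nil))
      (neg (.call nthId (.cons (snd 0) (.tail (fst 0))))))
    (.tail (fst 0))

/-- The values of all wires. -/
def gates : Expr :=
  .ite (fst 0)
    (.call gatesId (.cons (.tail (fst 0))
      (.call appId (.cons (snd 0)
        (.cons (.call gateId (.cons (.head (fst 0)) (snd 0))) .nil)))))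
    (snd 0)

/-- The values of the output wires. -/
def outs : Expr :=
  .ite (fst 0)
    (.cons (.call nthId (.cons (snd 0) (.head (fst 0))))
      (.call outsId (.cons (.tail (fst 0)) (snd 0))))
    .nil

/-- The prefix of a list that is as long as a given list. -/
def take : Expr :=
  .ite (fst 0)
    (.cons (.head (snd 0)) (.call takeId (.cons (.tail (fst 0)) (.tail (snd 0)))))
    .nil

/-- The rest of a list after such a prefix. -/
def drop : Expr :=
  .ite (fst 0) (.call dropId (.cons (.tail (fst 0)) (.tail (snd 0)))) (snd 0)

/-- Cut a bit string into the components of a point. -/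
def shape : Expr :=
  .ite (fst 0)
    (.cons (.call takeId (.cons (.head (fst 0)) (snd 0)))
      (.call shapeId (.cons (.tail (fst 0)) (.call dropId (.cons (.head (fst 0)) (snd 0))))))
    .nil

/-- The value of a circuit at a point. -/
def eval : Expr :=
  .call shapeId (.cons (snd 0)
    (.call outsId (.cons (.tail (fst 0))
      (.call gatesId (.cons (.head (fst 0)) (.call flatId (snd 0)))))))

/-- The point all of whose components are one. -/
def ones : Expr :=
  .ite (.var 0)
    (.cons (.cons tt (.call takeId (.cons (.tail (fst 0)) .nil))) (.call onesId (snd 0)))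
    .nil

/-- The circuit, from the argument of `solve`. -/
abbrev circ (i : ℕ) : Expr := .head (.var i)
/-- The mask, from the argument of `solve`. -/
abbrev mask (i : ℕ) : Expr := .head (.tail (.var i))
/-- The lower corner, from the argument of `solve`. -/
abbrev lo (i : ℕ) : Expr := .head (.tail (.tail (.var i)))
/-- The upper corner, from the argument of `solve`. -/
abbrev hi (i : ℕ) : Expr := .tail (.tail (.tail (.var i)))
/-- A call of `eval`; the argument of `solve` is variable `i`. -/
abbrev ev (i : ℕ) (e : Expr) : Expr := .call evalId (.cons (circ i) e)
/-- A call of `leAll`. -/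
abbrev cmp (e₁ e₂ : Expr) : Expr := .call leAllId (.cons e₁ e₂)
/-- A call of `sel`. -/
abbrev choose (e₁ e₂ e₃ : Expr) : Expr := .call selId (.cons e₁ (.cons e₂ e₃))
/-- A call of `solve`. -/
abbrev again (i : ℕ) (m l h : Expr) : Expr :=
  .call solveId (.cons (circ i) (.cons m (.cons l h)))
/-- The answer that two points violate monotonicity. -/
abbrev viol (e₁ e₂ : Expr) : Expr := .cons tt (.cons e₁ e₂)

/-- One step of upward iteration on a small box. -/
def climb : Expr :=
  .letIn (ev 1 (lo 1)) <|
  .letIn (choose (mask 2) (lo 2) (.var 0)) <|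
  .ite (cmp (.var 0) (lo 3))
    (.cons .nil (lo 3))
    (.ite (cmp (.var 1) (ev 3 (hi 3)))
      (.ite (cmp (.var 1) (ev 3 (.var 0)))
        (again 3 (mask 3) (.var 0) (hi 3))
        (viol (lo 3) (.var 0)))
      (viol (lo 3) (hi 3)))

/-- Continue with the upper or the lower part of the box. Variable `0` is the answer for the slice,
variable `4` the marked component, variable `5` the argument of `solve`. -/
def descend : Expr :=
  .ite (.head (.var 0)) (.var 0)
    (.ite (cmp (.tail (.var 0)) (choose (.var 4) (.tail (.var 0)) (ev 5 (.tail (.var 0)))))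
      (again 5 (mask 5) (.tail (.var 0)) (hi 5))
      (again 5 (mask 5) (lo 5) (.tail (.var 0))))

/-- Solve a slice of the box and go on with a half of the box. -/
def slice : Expr :=
  .letIn (.call avgAllId (.cons (lo 1) (hi 1))) <|
  .letIn (choose (.var 1) (lo 2) (.var 0)) <|
  .letIn (choose (.var 2) (hi 3) (.var 1)) <|
  .ite (cmp (ev 4 (lo 4)) (ev 4 (.var 1)))
    (.ite (cmp (ev 4 (.var 0)) (ev 4 (hi 4)))
      (.letIn (again 4 (choose (.var 3) (mask 4) .nil) (.var 1) (.var 0)) descend)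
      (viol (.var 0) (hi 4)))
    (viol (lo 4) (.var 1))

/-- Solve the problem in a box with respect to the components in a mask. -/
def solve : Expr :=
  .letIn (.call pickId (.cons (mask 0) (.cons (lo 0) (hi 0)))) (.ite (.var 0) slice climb)

/-- Start with the whole grid. -/
def main : Expr :=
  .call solveId (.cons (snd 0) (.cons (fst 0) (.cons (.call onesId (fst 0)) (fst 0))))

end Prog

/-- The algorithm. -/
def prog : Program :=
  [Prog.main, Prog.solve, Prog.le, Prog.leAll, Prog.add, Prog.avgAll, Prog.sel, Prog.big,
    Prog.pick, Prog.app, Prog.flat, Prog.nth, Prog.gate, Prog.gates, Prog.outs, Prog.take,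
    Prog.drop, Prog.shape, Prog.eval, Prog.ones]

/-- Function number `f` of the algorithm maps `a` to `v` within `t` steps. -/
abbrev Fn (f : ℕ) (a v : SExp) (t : ℕ) : Prop := EvalLE prog [a] (prog.getD f .nil) v t

theorem Fn.of_body {f : ℕ} {a v : SExp} {t : ℕ} (e : Expr) (he : prog.getD f .nil = e)
    (h : wp prog [a] e fun w s => w = v ∧ s ≤ t) : Fn f a v t := by
  subst he; exact EvalLE.of_wp h

/-! ### The functions on trees that the program computes -/

namespace SExp

theorem head_cons (a d : SExp) : (cons a d).head = a := rfl

theorem tail_cons (a d : SExp) : (cons a d).tail = d := rfl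

theorem head_nil : nil.head = nil := rfl

theorem tail_nil : nil.tail = nil := rfl

/-- Length along the right spine. -/
def len : SExp → ℕ
  | nil => 0
  | cons _ d => len d + 1

/-- Number of pairs. -/
def size : SExp → ℕ
  | nil => 0
  | cons a d => size a + size d + 1

theorem len_le_size (a : SExp) : a.len ≤ a.size := by
  induction a with
  | nil => exact le_rfl
  | cons a d _ ih => simp only [len, size]; omega

theorem size_head_add_tail_le (a : SExp) : a.head.size + a.tail.size ≤ a.size := by
  cases a <;> simp [head, tail, size]

/-- Test for `nil`. -/
def cond : SExp → SExp → SExp → SExp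
  | nil, _, e => e
  | cons _ _, t, _ => t

/-- The truth value `true`. -/
abbrev tru : SExp := cons nil nil

/-- The verdict on the bits read so far travels in the third argument; a more significant bit in
which the strings differ overrides it. -/
def le : SExp → SExp → SExp → SExp
  | nil, _, c => c
  | cons x a, b, c => le a b.tail (x.cond (b.head.cond c nil) (b.head.cond tru c))

def leAll : SExp → SExp → SExp
  | nil, _ => tru
  | cons a x, y => (le a y.head tru).cond (leAll x y.tail) nil

def add : SExp → SExp → SExp → SExp
  | nil, _, c => cons c nil
  | cons x a, b, c =>
    cons (x.cond (b.head.cond c (c.cond nil tru)) (b.head.cond (c.cond nil tru) c))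
      (add a b.tail (x.cond (b.head.cond tru c) (b.head.cond c nil)))

/-- Dropping the least significant bit halves the sum, and the carry bit keeps the length unchanged.
-/
def avg (a b : SExp) : SExp := (add a b nil).tail

def avgAll : SExp → SExp → SExp
  | nil, _ => nil
  | cons a x, y => cons (avg a y.head) (avgAll x y.tail)

def sel (m : SExp) : SExp → SExp → SExp
  | nil, _ => nil
  | cons a x, y => cons (m.head.cond y.head a) (sel m.tail x y.tail)

/-- For a ≤ b, three averages with a give a + ⌊(b - a) / 8⌋, which exceeds a exactly when the
difference is at least 8. -/
def big (a b : SExp) : SExp := le a (avg a (avg a (avg a b))) nil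

def pick (m : SExp) : SExp → SExp → SExp
  | nil, _ => nil
  | cons a x, y => (m.head.cond (big a y.head) nil).cond (cons tru nil)
      ((pick m.tail x y.tail).cond (cons nil (pick m.tail x y.tail)) nil)

def app : SExp → SExp → SExp
  | nil, b => b
  | cons x a, b => cons x (app a b)

def flat : SExp → SExp
  | nil => nil
  | cons a x => app a (flat x)

def nth (l : SExp) : SExp → SExp
  | nil => l.head
  | cons _ i => nth l.tail i

def gate (g vals : SExp) : SExp :=
  g.head.cond
    (g.head.tail.cond
      (g.head.tail.tail.cond
        ((nth vals g.tail.head).cond tru (nth vals g.tail.tail))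
        ((nth vals g.tail.head).cond (nth vals g.tail.tail) nil))
      ((nth vals g.tail).cond nil tru))
    g.tail

def gates : SExp → SExp → SExp
  | nil, vals => vals
  | cons g gs, vals => gates gs (app vals (cons (gate g vals) nil))

def outs : SExp → SExp → SExp
  | nil, _ => nil
  | cons o os, vals => cons (nth vals o) (outs os vals)

def take : SExp → SExp → SExp
  | nil, _ => nil
  | cons _ a, l => cons l.head (take a l.tail)

def drop : SExp → SExp → SExp
  | nil, l => l
  | cons _ a, l => drop a l.tail

def shape : SExp → SExp → SExp
  | nil, _ => nil
  | cons a x, l => cons (take a l) (shape x (drop a l))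

def evalAt (C x : SExp) : SExp := shape x (outs C.tail (gates C.head (flat x)))

def ones : SExp → SExp
  | nil => nil
  | cons a x => cons (cons tru (take a.tail nil)) (ones x)

end SExp

/-! ### Correctness and running time of the functions on trees -/

open SExp

/-- The time bounds here and below are deliberately coarse: a coefficient only has to cover one
unfolding, helper calls included, so that linear arithmetic closes the induction. -/
theorem fn_le (a b c : SExp) : Fn Prog.leId (.cons a (.cons b c)) (le a b c) (40 * a.len + 40) := by
  induction a generalizing b c with
  | nil =>
    refine Fn.of_body Prog.le rfl ?_
    simp [Prog.le, wp, head, tail, SExp.le, len]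
  | cons x a _ ih =>
    refine Fn.of_body Prog.le rfl ?_
    simp only [Prog.le, wp, List.getD_cons_zero, head_cons, tail_cons, SExp.le, len]
    rcases x with _ | _ <;> rcases b.head with _ | _ <;>
      exact CallSpec.intro (ih _ _) ⟨rfl, by omega⟩

theorem fn_leAll (x y : SExp) : Fn Prog.leAllId (.cons x y) (leAll x y) (100 * x.size + 40) := by
  induction x generalizing y with
  | nil =>
    refine Fn.of_body Prog.leAll rfl ?_
    simp [Prog.leAll, wp, head, SExp.leAll, size]
  | cons a x _ ih =>
    refine Fn.of_body Prog.leAll rfl ?_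
    have := a.len_le_size
    simp only [Prog.leAll, wp, List.getD_cons_zero, head_cons, tail_cons, SExp.leAll, size]
    refine CallSpec.intro (fn_le _ _ _) ?_
    rcases SExp.le a y.head tru with _ | _
    · exact ⟨rfl, by omega⟩
    · exact CallSpec.intro (ih _) ⟨rfl, by omega⟩

theorem fn_add (a b c : SExp) :
    Fn Prog.addId (.cons a (.cons b c)) (add a b c) (50 * a.len + 40) := by
  induction a generalizing b c with
  | nil =>
    refine Fn.of_body Prog.add rfl ?_
    simp [Prog.add, wp, head, tail, SExp.add, len]
  | cons x a _ ih =>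
    refine Fn.of_body Prog.add rfl ?_
    simp only [Prog.add, wp, List.getD_cons_zero, head_cons, tail_cons, SExp.add, len]
    rcases x with _ | _ <;> rcases b.head with _ | _ <;> rcases c with _ | _ <;>
      exact CallSpec.intro (ih _ _) ⟨rfl, by omega⟩

theorem fn_avgAll (x y : SExp) :
    Fn Prog.avgAllId (.cons x y) (avgAll x y) (100 * x.size + 40) := by
  induction x generalizing y with
  | nil =>
    refine Fn.of_body Prog.avgAll rfl ?_
    simp [Prog.avgAll, wp, head, SExp.avgAll, size]
  | cons a x _ ih =>
    refine Fn.of_body Prog.avgAll rfl ?_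
    have := a.len_le_size
    simp only [Prog.avgAll, wp, List.getD_cons_zero, head_cons, tail_cons, SExp.avgAll, size]
    exact CallSpec.intro (fn_add _ _ _) (CallSpec.intro (ih _) ⟨rfl, by omega⟩)

theorem fn_sel (m x y : SExp) :
    Fn Prog.selId (.cons m (.cons x y)) (sel m x y) (50 * x.size + 40) := by
  induction x generalizing m y with
  | nil =>
    refine Fn.of_body Prog.sel rfl ?_
    simp [Prog.sel, wp, head, tail, SExp.sel, size]
  | cons a x _ ih =>
    refine Fn.of_body Prog.sel rfl ?_
    simp only [Prog.sel, wp, List.getD_cons_zero, head_cons, tail_cons, SExp.sel, size]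
    rcases m.head with _ | _ <;> exact CallSpec.intro (ih _ _) ⟨rfl, by omega⟩

theorem fn_big (a b : SExp) : Fn Prog.bigId (.cons a b) (big a b) (200 * a.len + 300) := by
  refine Fn.of_body Prog.big rfl ?_
  simp only [Prog.big, wp, List.getD_cons_zero, head_cons, tail_cons, SExp.big, SExp.avg]
  exact CallSpec.intro (fn_add _ _ _) (CallSpec.intro (fn_add _ _ _) (CallSpec.intro (fn_add _ _ _)
    (CallSpec.intro (fn_le _ _ _) ⟨rfl, by omega⟩)))

theorem fn_pick (m x y : SExp) :
    Fn Prog.pickId (.cons m (.cons x y)) (pick m x y) (400 * x.size + 40) := by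
  induction x generalizing m y with
  | nil =>
    refine Fn.of_body Prog.pick rfl ?_
    simp [Prog.pick, wp, head, tail, SExp.pick, size]
  | cons a x _ ih =>
    refine Fn.of_body Prog.pick rfl ?_
    have := a.len_le_size
    simp only [Prog.pick, wp, List.getD_cons_zero, head_cons, tail_cons, SExp.pick, size]
    rcases m.head with _ | _
    · refine CallSpec.intro (ih _ _) ?_
      rcases pick m.tail x y.tail with _ | _ <;> exact ⟨rfl, by omega⟩
    · refine CallSpec.intro (fn_big _ _) ?_
      rcases big a y.head with _ | _
      · refine CallSpec.intro (ih _ _) ?_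
        rcases pick m.tail x y.tail with _ | _ <;> exact ⟨rfl, by omega⟩
      · exact ⟨rfl, by omega⟩

theorem fn_app (a b : SExp) : Fn Prog.appId (.cons a b) (app a b) (40 * a.len + 40) := by
  induction a generalizing b with
  | nil =>
    refine Fn.of_body Prog.app rfl ?_
    simp [Prog.app, wp, head, tail, SExp.app, len]
  | cons x a _ ih =>
    refine Fn.of_body Prog.app rfl ?_
    simp only [Prog.app, wp, List.getD_cons_zero, head_cons, tail_cons, SExp.app, len]
    exact CallSpec.intro (ih _) ⟨rfl, by omega⟩

theorem fn_flat (x : SExp) : Fn Prog.flatId x (flat x) (100 * x.size + 40) := by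
  induction x with
  | nil =>
    refine Fn.of_body Prog.flat rfl ?_
    simp [Prog.flat, wp, SExp.flat, size]
  | cons a x _ ih =>
    refine Fn.of_body Prog.flat rfl ?_
    have := a.len_le_size
    simp only [Prog.flat, wp, List.getD_cons_zero, head_cons, tail_cons, SExp.flat, size]
    exact CallSpec.intro ih (CallSpec.intro (fn_app _ _) ⟨rfl, by omega⟩)

theorem fn_nth (l i : SExp) : Fn Prog.nthId (.cons l i) (nth l i) (40 * i.len + 40) := by
  induction i generalizing l with
  | nil =>
    refine Fn.of_body Prog.nth rfl ?_
    simp [Prog.nth, wp, head, tail, SExp.nth, len]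
  | cons _ i _ ih =>
    refine Fn.of_body Prog.nth rfl ?_
    simp only [Prog.nth, wp, List.getD_cons_zero, head_cons, tail_cons, SExp.nth, len]
    exact CallSpec.intro (ih _) ⟨rfl, by omega⟩

theorem fn_gate (g v : SExp) : Fn Prog.gateId (.cons g v) (gate g v) (50 * g.size + 150) := by
  refine Fn.of_body Prog.gate rfl ?_
  have h₁ := g.size_head_add_tail_le
  have h₂ := g.tail.size_head_add_tail_le
  have h₃ := g.tail.len_le_size
  have h₄ := g.tail.head.len_le_size
  have h₅ := g.tail.tail.len_le_size
  simp only [Prog.gate, wp, List.getD_cons_zero, head_cons, tail_cons, SExp.gate]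
  rcases g.head with _ | ⟨_, _ | ⟨_, _ | _⟩⟩
  · exact ⟨rfl, by omega⟩
  · refine CallSpec.intro (fn_nth _ _) ?_
    rcases nth v g.tail with _ | _ <;> exact ⟨rfl, by omega⟩
  · refine CallSpec.intro (fn_nth _ _) ?_
    simp only [SExp.cond]
    rcases nth v g.tail.head with _ | _
    · exact ⟨rfl, by omega⟩
    · exact CallSpec.intro (fn_nth _ _) ⟨rfl, by omega⟩
  · refine CallSpec.intro (fn_nth _ _) ?_
    simp only [SExp.cond]
    rcases nth v g.tail.head with _ | _
    · exact CallSpec.intro (fn_nth _ _) ⟨rfl, by omega⟩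
    · exact ⟨rfl, by omega⟩

theorem len_app (a b : SExp) : (app a b).len = a.len + b.len := by
  induction a with
  | nil => simp [app, len]
  | cons x a _ ih => simp only [app, len, ih]; omega

/-- Each gate copies the list of wires in order to append to it, hence a quadratic bound. -/
theorem fn_gates (g v : SExp) :
    Fn Prog.gatesId (.cons g v) (gates g v) (50 * g.size + g.len * (40 * (v.len + g.len) + 250) + 40) := by
  induction g generalizing v with
  | nil =>
    refine Fn.of_body Prog.gates rfl ?_
    simp [Prog.gates, wp, head, tail, SExp.gates, len, size]
  | cons g gs _ ih =>
    refine Fn.of_body Prog.gates rfl ?_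
    simp only [Prog.gates, wp, List.getD_cons_zero, head_cons, tail_cons, SExp.gates, len, size]
    refine CallSpec.intro (fn_gate _ _) (CallSpec.intro (fn_app _ _) (CallSpec.intro (ih _) ⟨rfl, ?_⟩))
    rw [len_app]
    simp only [len]
    -- Wires known plus gates remaining is constant along the recursion, so the bound is phrased
    -- with this sum.
    have : v.len + (0 + 1) + gs.len = v.len + (gs.len + 1) := by omega
    rw [this, add_mul _ 1]
    omega

theorem fn_outs (o v : SExp) : Fn Prog.outsId (.cons o v) (outs o v) (80 * o.size + 40) := by
  induction o with
  | nil =>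
    refine Fn.of_body Prog.outs rfl ?_
    simp [Prog.outs, wp, head, SExp.outs, size]
  | cons a x _ ih =>
    refine Fn.of_body Prog.outs rfl ?_
    have := a.len_le_size
    simp only [Prog.outs, wp, List.getD_cons_zero, head_cons, tail_cons, SExp.outs, size]
    exact CallSpec.intro (fn_nth _ _) (CallSpec.intro ih ⟨rfl, by omega⟩)

theorem fn_take (a l : SExp) : Fn Prog.takeId (.cons a l) (take a l) (40 * a.len + 40) := by
  induction a generalizing l with
  | nil =>
    refine Fn.of_body Prog.take rfl ?_
    simp [Prog.take, wp, head, SExp.take, len]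
  | cons x a _ ih =>
    refine Fn.of_body Prog.take rfl ?_
    simp only [Prog.take, wp, List.getD_cons_zero, head_cons, tail_cons, SExp.take, len]
    exact CallSpec.intro (ih _) ⟨rfl, by omega⟩

theorem fn_drop (a l : SExp) : Fn Prog.dropId (.cons a l) (drop a l) (40 * a.len + 40) := by
  induction a generalizing l with
  | nil =>
    refine Fn.of_body Prog.drop rfl ?_
    simp [Prog.drop, wp, head, tail, SExp.drop, len]
  | cons x a _ ih =>
    refine Fn.of_body Prog.drop rfl ?_
    simp only [Prog.drop, wp, List.getD_cons_zero, head_cons, tail_cons, SExp.drop, len]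
    exact CallSpec.intro (ih _) ⟨rfl, by omega⟩

theorem fn_shape (x l : SExp) : Fn Prog.shapeId (.cons x l) (shape x l) (150 * x.size + 40) := by
  induction x generalizing l with
  | nil =>
    refine Fn.of_body Prog.shape rfl ?_
    simp [Prog.shape, wp, head, SExp.shape, size]
  | cons a x _ ih =>
    refine Fn.of_body Prog.shape rfl ?_
    have := a.len_le_size
    simp only [Prog.shape, wp, List.getD_cons_zero, head_cons, tail_cons, SExp.shape, size]
    exact CallSpec.intro (fn_take _ _) (CallSpec.intro (fn_drop _ _) (CallSpec.intro (ih _) ⟨rfl, by omega⟩))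

theorem len_flat_le (x : SExp) : (flat x).len ≤ x.size := by
  induction x with
  | nil => simp [flat, len]
  | cons a x _ ih =>
    have := a.len_le_size
    simp only [flat, len_app, size]; omega

theorem fn_eval (C x : SExp) {S : ℕ} (hC : C.size ≤ S) (hx : x.size ≤ S) :
    Fn Prog.evalId (.cons C x) (evalAt C x) (80 * S * S + 1000 * S + 300) := by
  refine Fn.of_body Prog.eval rfl ?_
  have h₁ := C.size_head_add_tail_le
  have h₂ := C.head.len_le_size
  have h₃ := len_flat_le x
  simp only [Prog.eval, wp, List.getD_cons_zero, head_cons, tail_cons, SExp.evalAt]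
  refine CallSpec.intro (fn_flat _) (CallSpec.intro (fn_gates _ _) (CallSpec.intro (fn_outs _ _)
    (CallSpec.intro (fn_shape _ _) ⟨rfl, ?_⟩)))
  have : C.head.len * (40 * ((flat x).len + C.head.len) + 250) ≤ S * (40 * (S + S) + 250) := by
    gcongr <;> omega
  nlinarith

theorem fn_ones (x : SExp) : Fn Prog.onesId x (ones x) (100 * x.size + 40) := by
  induction x with
  | nil =>
    refine Fn.of_body Prog.ones rfl ?_
    simp [Prog.ones, wp, SExp.ones, size]
  | cons a x _ ih =>
    refine Fn.of_body Prog.ones rfl ?_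
    have := a.tail.len_le_size
    have := a.size_head_add_tail_le
    simp only [Prog.ones, wp, List.getD_cons_zero, head_cons, tail_cons, SExp.ones, size]
    exact CallSpec.intro (fn_take _ _) (CallSpec.intro ih ⟨rfl, by omega⟩)

/-! ### Numbers in binary -/

/-- The code of the `b` lowest bits of a number. -/
def bitsCode (b n : ℕ) : SExp := encodeList encodeBool (bits b n)

theorem bitsCode_zero (n : ℕ) : bitsCode 0 n = .nil := rfl

theorem bits_succ (b n : ℕ) : bits (b + 1) n = n.testBit 0 :: bits b (n / 2) := by
  simp [bits, List.range_succ_eq_map, Nat.testBit_succ]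

theorem length_bits (b n : ℕ) : (bits b n).length = b := by simp [bits]

theorem bitsCode_succ (b n : ℕ) :
    bitsCode (b + 1) n = .cons (encodeBool (n.testBit 0)) (bitsCode b (n / 2)) := by
  simp [bitsCode, bits_succ, encodeList]

theorem size_encodeBool_le (c : Bool) : (encodeBool c).size ≤ 1 := by
  cases c <;> simp [encodeBool, size]

theorem size_bitsCode_le (b n : ℕ) : (bitsCode b n).size ≤ 2 * b := by
  induction b generalizing n with
  | zero => simp [bitsCode_zero, size]
  | succ b ih =>
    have := ih (n / 2)
    have := size_encodeBool_le (n.testBit 0)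
    simp only [bitsCode_succ, size]; omega

theorem cond_encodeBool (c : Bool) (s t : SExp) :
    (encodeBool c).cond s t = if c then s else t := by
  cases c <;> rfl

/-- The halves of x and y decide the comparison unless they agree; then the parities, and finally c,
decide. This is the updated verdict passed to the recursive call. -/
theorem le_bitsCode {b x y : ℕ} (hx : x < 2 ^ b) (hy : y < 2 ^ b) (c : Bool) :
    le (bitsCode b x) (bitsCode b y) (encodeBool c) =
      encodeBool (decide (x < y) || (c && decide (x = y))) := by
  induction b generalizing x y c with
  | zero =>
    obtain rfl : x = 0 := by simpa using hx
    obtain rfl : y = 0 := by simpa using hy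
    cases c <;> rfl
  | succ b ih =>
    rw [pow_succ] at hx hy
    have key : ∀ d : Bool, d = (if x % 2 = 1 then (if y % 2 = 1 then c else false)
        else (if y % 2 = 1 then true else c)) →
        le (bitsCode b (x / 2)) (bitsCode b (y / 2)) (encodeBool d) =
          encodeBool (decide (x < y) || (c && decide (x = y))) := by
      rintro d rfl
      rw [ih (by omega) (by omega)]
      congr 1
      rw [Bool.eq_iff_iff]
      cases c <;> rcases Nat.mod_two_eq_zero_or_one x with h | h <;>
        rcases Nat.mod_two_eq_zero_or_one y with h' | h' <;> simp only [h, h'] <;>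
        simp <;> omega
    rw [bitsCode_succ, bitsCode_succ, SExp.le, tail_cons, head_cons, ← key _ rfl]
    congr 1
    simp only [Nat.testBit_zero, cond_encodeBool]
    rcases Nat.mod_two_eq_zero_or_one x with h | h <;>
      rcases Nat.mod_two_eq_zero_or_one y with h' | h' <;> simp [h, h', encodeBool]

theorem add_bitsCode {b x y : ℕ} (hx : x < 2 ^ b) (hy : y < 2 ^ b) (c : Bool) :
    add (bitsCode b x) (bitsCode b y) (encodeBool c) = bitsCode (b + 1) (x + y + c.toNat) := by
  induction b generalizing x y c with
  | zero =>
    obtain rfl : x = 0 := by simpa using hx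
    obtain rfl : y = 0 := by simpa using hy
    cases c <;> simp [bitsCode_succ, bitsCode_zero, add, encodeBool]
  | succ b ih =>
    rw [pow_succ] at hx hy
    rw [bitsCode_succ b, bitsCode_succ b, bitsCode_succ (b + 1), SExp.add, tail_cons, head_cons]
    have key : ∀ d : Bool, d.toNat = (x % 2 + y % 2 + c.toNat) / 2 →
        add (bitsCode b (x / 2)) (bitsCode b (y / 2)) (encodeBool d) =
          bitsCode (b + 1) ((x + y + c.toNat) / 2) := by
      intro d hd
      rw [ih (by omega) (by omega), hd]
      congr 1
      omega
    rw [← key (if x % 2 = 1 then (if y % 2 = 1 then true else c)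
        else (if y % 2 = 1 then c else false))]
    · simp only [Nat.testBit_zero, cond_encodeBool]
      rcases Nat.mod_two_eq_zero_or_one x with h | h <;>
        rcases Nat.mod_two_eq_zero_or_one y with h' | h' <;> cases c <;>
        simp [h, h', encodeBool, Nat.add_mod]
    · rcases Nat.mod_two_eq_zero_or_one x with h | h <;>
        rcases Nat.mod_two_eq_zero_or_one y with h' | h' <;> cases c <;>
        simp [h, h']

theorem avg_bitsCode {b x y : ℕ} (hx : x < 2 ^ b) (hy : y < 2 ^ b) :
    avg (bitsCode b x) (bitsCode b y) = bitsCode b ((x + y) / 2) := by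
  have := add_bitsCode hx hy false
  rw [avg, show SExp.nil = encodeBool false from rfl, this, bitsCode_succ, tail_cons]
  rfl

theorem big_bitsCode {b x y : ℕ} (hxy : x ≤ y) (hy : y < 2 ^ b) :
    big (bitsCode b x) (bitsCode b y) = encodeBool (decide (8 ≤ y - x)) := by
  rw [big, avg_bitsCode (by omega) hy, avg_bitsCode (by omega) (by omega),
    avg_bitsCode (by omega) (by omega), show SExp.nil = encodeBool false from rfl,
    le_bitsCode (by omega) (by omega)]
  congr 1
  simp only [Bool.false_and, Bool.or_false, decide_eq_decide]
  omega

/-! ### Points -/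

variable {k b : ℕ}

/-- The code of a point with coordinates of `b` bits. -/
def ptCode (b : ℕ) (x : Fin k → ℕ) : SExp :=
  encodeList (encodeList encodeBool) (List.ofFn fun i => bits b (x i))

theorem ptCode_zero (x : Fin 0 → ℕ) : ptCode b x = .nil := by simp [ptCode, encodeList]

theorem ptCode_succ (x : Fin (k + 1) → ℕ) :
    ptCode b x = .cons (bitsCode b (x 0)) (ptCode b (Fin.tail x)) := by
  simp [ptCode, List.ofFn_succ, encodeList, bitsCode, Fin.tail]

theorem size_ptCode_le (x : Fin k → ℕ) : (ptCode b x).size ≤ k * (2 * b + 1) := by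
  induction k with
  | zero => simp [ptCode_zero, size]
  | succ k ih =>
    have := ih (Fin.tail x)
    have := size_bitsCode_le b (x 0)
    simp only [ptCode_succ, size, add_mul]; omega

open Classical in
theorem leAll_ptCode {x y : Fin k → ℕ} (hx : ∀ i, x i < 2 ^ b) (hy : ∀ i, y i < 2 ^ b) :
    leAll (ptCode b x) (ptCode b y) = encodeBool (decide (x ≤ y)) := by
  induction k with
  | zero =>
    simp [ptCode_zero, leAll, encodeBool]
  | succ k ih =>
    have h : x ≤ y ↔ x 0 ≤ y 0 ∧ Fin.tail x ≤ Fin.tail y := by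
      simp only [Pi.le_def, Fin.forall_fin_succ, Fin.tail]
    rw [ptCode_succ, ptCode_succ, leAll, head_cons, tail_cons,
      show tru = encodeBool true from rfl, le_bitsCode (hx 0) (hy 0),
      ih (x := Fin.tail x) (y := Fin.tail y) (fun i => hx _) (fun i => hy _), cond_encodeBool]
    simp only [h, Bool.decide_and, Bool.true_and]
    have : (decide (x 0 < y 0) || decide (x 0 = y 0)) = decide (x 0 ≤ y 0) := by
      rw [← Bool.decide_or, decide_eq_decide]; omega
    rw [this]
    by_cases h0 : x 0 ≤ y 0 <;> simp [h0, encodeBool]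

theorem avgAll_ptCode {x y : Fin k → ℕ} (hx : ∀ i, x i < 2 ^ b) (hy : ∀ i, y i < 2 ^ b) :
    avgAll (ptCode b x) (ptCode b y) = ptCode b fun i => (x i + y i) / 2 := by
  induction k with
  | zero => simp [ptCode_zero, avgAll]
  | succ k ih =>
    rw [ptCode_succ, ptCode_succ, avgAll, head_cons, tail_cons, avg_bitsCode (hx 0) (hy 0),
      ih (x := Fin.tail x) (y := Fin.tail y) (fun i => hx _) (fun i => hy _), ptCode_succ]
    rfl

/-! ### Masks of coordinates -/

/-- Whether a tree differs from `nil`. -/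
def SExp.truth : SExp → Bool
  | nil => false
  | cons _ _ => true

/-- Whether the component with number `i` is marked. -/
def SExp.flag : SExp → ℕ → Bool
  | m, 0 => m.head.truth
  | m, i + 1 => m.tail.flag i

theorem flag_nil (i : ℕ) : SExp.nil.flag i = false := by
  induction i with
  | zero => rfl
  | succ i ih => exact ih

theorem cond_eq_truth (m s t : SExp) : m.cond s t = if m.truth then s else t := by
  cases m <;> rfl

theorem sel_ptCode (m : SExp) (x y : Fin k → ℕ) :
    sel m (ptCode b x) (ptCode b y) = ptCode b fun i => if m.flag i then y i else x i := by
  induction k generalizing m with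
  | zero => simp [ptCode_zero, sel]
  | succ k ih =>
    rw [ptCode_succ, ptCode_succ, sel, head_cons, tail_cons, ih, ptCode_succ, cond_eq_truth]
    congr 1
    simp only [Fin.val_zero, flag]
    split_ifs <;> rfl

/-- Selecting from the empty tree erases the entries marked in d; this is how a coordinate leaves
the mask of a slice. -/
theorem flag_sel (d m : SExp) (i : ℕ) : (sel d m .nil).flag i = (m.flag i && !d.flag i) := by
  induction m generalizing d i with
  | nil => simp [sel, flag_nil]
  | cons a m _ ih =>
    cases i with
    | zero =>
      simp only [sel, flag, head_cons]
      rcases d.head with _ | _ <;> simp [SExp.cond, truth, head_nil]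
    | succ i => simp only [sel, flag, tail_cons, tail_nil, ih]

theorem size_sel_le (d m : SExp) : (sel d m .nil).size ≤ m.size := by
  induction m generalizing d with
  | nil => simp [sel]
  | cons a m _ ih =>
    have := ih d.tail
    simp only [sel, size, tail_nil, head_nil]
    rcases d.head with _ | _ <;> simp only [SExp.cond, size] <;> omega

/-- These are the two cases of the main loop. A nonempty result serves both as the outcome of the
test and as the mask of the single coordinate j, since entries past the end count as unmarked. -/
theorem pick_ptCode (m : SExp) {x y : Fin k → ℕ} (hxy : x ≤ y) (hy : ∀ i, y i < 2 ^ b) :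
    (pick m (ptCode b x) (ptCode b y) = .nil ∧ ∀ i : Fin k, m.flag i → y i - x i < 8) ∨
    ∃ (a d : SExp) (j : Fin k), pick m (ptCode b x) (ptCode b y) = .cons a d ∧ m.flag j ∧
      8 ≤ y j - x j ∧ ∀ i : Fin k, (SExp.cons a d).flag i = decide (i = j) := by
  induction k generalizing m with
  | zero => exact .inl ⟨by simp [ptCode_zero, pick], fun i => i.elim0⟩
  | succ k ih =>
    rw [ptCode_succ, ptCode_succ, pick, head_cons, tail_cons, big_bitsCode (hxy 0) (hy 0)]
    have hc : m.head.cond (encodeBool (decide (8 ≤ y 0 - x 0))) .nil =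
        encodeBool (m.flag 0 && decide (8 ≤ y 0 - x 0)) := by
      rw [flag]; rcases m.head with _ | _ <;> simp [SExp.cond, truth, encodeBool]
    rw [hc, cond_encodeBool]
    by_cases h0 : m.flag 0 ∧ 8 ≤ y 0 - x 0
    · refine .inr ⟨tru, .nil, 0, by simp [h0], h0.1, h0.2, fun i => ?_⟩
      induction i using Fin.cases with
      | zero => rfl
      | succ i => simp [flag, tail_cons, flag_nil]
    · rw [if_neg (by simpa using h0)]
      rcases ih m.tail (x := Fin.tail x) (y := Fin.tail y) (fun i => hxy _) (fun i => hy _) with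
        ⟨h₁, h₂⟩ | ⟨a, d, j, h₁, h₂, h₃, h₄⟩
      · refine .inl ⟨by simp [h₁, SExp.cond], fun i hi => ?_⟩
        induction i using Fin.cases with
        | zero => by_contra h; exact h0 ⟨hi, by omega⟩
        | succ i => exact h₂ i hi
      · refine .inr ⟨.nil, .cons a d, j.succ, by simp [h₁, SExp.cond], h₂, h₃, fun i => ?_⟩
        induction i using Fin.cases with
        | zero => simp [flag, head_cons, truth, (Fin.succ_ne_zero j).symm]
        | succ i => simpa [flag, tail_cons] using h₄ i

/-- Reading past the end yields `nil`, that is, zero bits; this supplies the high bits of the number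
one. -/
theorem take_nil (n : ℕ) : take (bitsCode b n) .nil = bitsCode b 0 := by
  induction b generalizing n with
  | zero => rfl
  | succ b ih => simp [bitsCode_succ, take, head_nil, tail_nil, ih, encodeBool]

theorem ones_ptCode (x : Fin k → ℕ) : ones (ptCode (b + 1) x) = ptCode (b + 1) (fun _ : Fin k => 1) := by
  induction k with
  | zero => simp [ptCode_zero, ones]
  | succ k ih =>
    rw [ptCode_succ, ones, ih, ptCode_succ, bitsCode_succ, tail_cons, take_nil, bitsCode_succ]
    rfl

/-! ### Circuits -/

section Circuits

variable {α : Type} (e : α → SExp)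

theorem app_encodeList (l l' : List α) :
    app (encodeList e l) (encodeList e l') = encodeList e (l ++ l') := by
  induction l with
  | nil => rfl
  | cons a l ih => simp [encodeList, app, ih]

theorem flat_encodeList (L : List (List α)) :
    flat (encodeList (encodeList e) L) = encodeList e L.flatten := by
  induction L with
  | nil => rfl
  | cons l L ih => simp [encodeList, flat, ih, app_encodeList]

theorem take_encodeList {β : Type} (e' : β → SExp) {s : List β} {l : List α} (r : List α)
    (h : s.length = l.length) :
    take (encodeList e' s) (encodeList e (l ++ r)) = encodeList e l := by
  induction s generalizing l with
  | nil => obtain rfl := List.eq_nil_of_length_eq_zero h.symm; rfl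
  | cons a s ih =>
    cases l with
    | nil => simp at h
    | cons c l => simp [encodeList, take, head_cons, tail_cons, ih (by simpa using h)]

theorem drop_encodeList {β : Type} (e' : β → SExp) {s : List β} {l : List α} (r : List α)
    (h : s.length = l.length) :
    drop (encodeList e' s) (encodeList e (l ++ r)) = encodeList e r := by
  induction s generalizing l with
  | nil => obtain rfl := List.eq_nil_of_length_eq_zero h.symm; rfl
  | cons a s ih =>
    cases l with
    | nil => simp at h
    | cons c l => simp [encodeList, drop, tail_cons, ih (by simpa using h)]

end Circuits

theorem nth_encodeList (l : List Bool) (i : ℕ) :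
    nth (encodeList encodeBool l) (encodeUnary i) = encodeBool (l.getD i false) := by
  induction i generalizing l with
  | zero => cases l <;> rfl
  | succ i ih =>
    cases l with
    | nil =>
      have := ih []
      simpa [encodeUnary, nth, encodeList, tail_nil] using this
    | cons a l => simpa [encodeUnary, nth, encodeList, tail_cons] using ih l

theorem gate_encodeGate (g : Gate) (vals : List Bool) :
    gate (encodeGate g) (encodeList encodeBool vals) = encodeBool (g.eval vals) := by
  cases g <;> simp only [encodeGate, gate, head_cons, tail_cons, encodeUnary, SExp.cond.eq_1,
    SExp.cond.eq_2, nth_encodeList, cond_encodeBool, Gate.eval]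
  · generalize vals.getD _ false = u
    cases u <;> rfl
  · generalize vals.getD _ false = u
    cases u <;> rfl
  · generalize vals.getD _ false = u
    cases u <;> rfl

theorem gates_encodeList (gs : List Gate) (vals : List Bool) :
    gates (encodeList encodeGate gs) (encodeList encodeBool vals) =
      encodeList encodeBool (gs.foldl (fun vals g => vals ++ [g.eval vals]) vals) := by
  induction gs generalizing vals with
  | nil => rfl
  | cons g gs ih =>
    rw [encodeList, gates, gate_encodeGate, List.foldl_cons, ← ih]
    congr 1
    exact app_encodeList encodeBool vals [g.eval vals]

theorem outs_encodeList (os : List ℕ) (vals : List Bool) :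
    outs (encodeList encodeUnary os) (encodeList encodeBool vals) =
      encodeList encodeBool (os.map fun w => vals.getD w false) := by
  induction os with
  | nil => rfl
  | cons o os ih => rw [encodeList, outs, ih, nth_encodeList]; rfl

/-- Only the lengths of x matter: the input point of a circuit serves as the template for cutting up
its output. -/
theorem shape_ptCode (x y : Fin k → ℕ) :
    shape (ptCode b x) (encodeList encodeBool (List.ofFn fun i => bits b (y i)).flatten) =
      ptCode b y := by
  induction k with
  | zero => simp [ptCode_zero, shape]
  | succ k ih =>
    rw [ptCode_succ, ptCode_succ, shape, List.ofFn_succ, List.flatten_cons, bitsCode,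
      take_encodeList _ _ _ (by simp [length_bits]), drop_encodeList _ _ _ (by simp [length_bits])]
    congr 1
    exact ih (Fin.tail x) (Fin.tail y)

theorem evalAt_encodeCircuit {N : Fin k → ℕ} {f : Grid N → Grid N}
    {C : Circuit (k * bitLength N) (k * bitLength N)} (hC : C.Presents f) (x : Grid N) :
    evalAt (encodeCircuit C) (ptCode (bitLength N) x.1) = ptCode (bitLength N) (f x).1 := by
  have h := hC x
  rw [Circuit.eval] at h
  rw [evalAt, encodeCircuit, head_cons, tail_cons]
  conv_lhs => enter [2, 2, 2]; rw [ptCode, flat_encodeList]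
  rw [gates_encodeList, outs_encodeList]
  erw [h]
  exact shape_ptCode _ _

/-! ### Sizes of encoded circuits -/

theorem size_encodeUnary (n : ℕ) : (encodeUnary n).size = n := by
  induction n with
  | zero => rfl
  | succ n ih => simp [encodeUnary, size, ih]

theorem size_encodeList_le {α : Type} (e : α → SExp) (l : List α) {s : ℕ}
    (h : ∀ a ∈ l, (e a).size ≤ s) : (encodeList e l).size ≤ l.length * (s + 1) := by
  induction l with
  | nil => simp [encodeList, size]
  | cons a l ih =>
    have h₁ := h a (by simp)
    have h₂ := ih fun a ha => h a (by simp [ha])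
    rw [encodeList, size, List.length_cons, Nat.add_one_mul]; omega

theorem size_encodeGate_le {g : Gate} {s : ℕ} (h : ∀ w ∈ g.inputs, w < s) :
    (encodeGate g).size ≤ 2 * s + 5 := by
  cases g with
  | const c =>
    have := size_encodeBool_le c
    simp only [encodeGate, size, size_encodeUnary]; omega
  | not i =>
    have := h i (by simp [Gate.inputs])
    simp only [encodeGate, size, size_encodeUnary]; omega
  | and i j =>
    have := h i (by simp [Gate.inputs])
    have := h j (by simp [Gate.inputs])
    simp only [encodeGate, size, size_encodeUnary]; omega
  | or i j =>
    have := h i (by simp [Gate.inputs])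
    have := h j (by simp [Gate.inputs])
    simp only [encodeGate, size, size_encodeUnary]; omega

theorem size_encodeCircuit_le {m l : ℕ} (C : Circuit m l) :
    (encodeCircuit C).size ≤ (C.size + l) * (2 * (m + C.size) + 6) + 1 := by
  have h₁ := size_encodeList_le encodeGate C.gates (s := 2 * (m + C.size) + 5) fun g hg => by
    obtain ⟨i, hi, rfl⟩ := List.getElem_of_mem hg
    exact size_encodeGate_le fun w hw => by
      have := C.gates_lt i hi w hw
      unfold Circuit.size; omega
  have h₂ := size_encodeList_le encodeUnary C.outputs (s := 2 * (m + C.size) + 5) fun w hw => by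
    have := C.outputs_lt w hw
    rw [size_encodeUnary]; unfold Circuit.size; omega
  rw [C.length_outputs] at h₂
  simp only [encodeCircuit, size, add_mul _ l]
  change _ ≤ C.size * (2 * (m + C.size) + 6) at h₁
  change _ ≤ l * (2 * (m + C.size) + 6) at h₂
  omega

/-! ### The number of calls -/

/-- Bound for one more than the number of slices that are needed in a coordinate of range `d`. -/
def rounds (d : ℕ) : ℕ := max 1 (Nat.log 2 (d - 1))

theorem rounds_pos (d : ℕ) : 1 ≤ rounds d := le_max_left _ _

theorem rounds_mono : Monotone rounds := fun _ _ h =>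
  max_le_max le_rfl (Nat.log_mono_right (Nat.sub_le_sub_right h 1))

/-- Subtracting one absorbs the rounding: e - 1 ≤ (d - 1) / 2, so the logarithm drops by one. As d ≥
8 the logarithm of d - 1 is at least 2, so the maximum with 1 does no harm. -/
theorem rounds_half {d e : ℕ} (hd : 8 ≤ d) (he : e ≤ (d + 1) / 2) :
    rounds e + 1 ≤ rounds d := by
  have h₁ : 2 ≤ Nat.log 2 (d - 1) := Nat.le_log_of_pow_le (by norm_num) (by omega)
  have h₂ : Nat.log 2 (e - 1) ≤ Nat.log 2 (d - 1) - 1 := by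
    rw [← Nat.log_div_base]
    exact Nat.log_mono_right (by omega)
  unfold rounds
  omega

section Potential

variable {k : ℕ}

/-- Bound for the number of boxes without a large range. -/
def leaves (p : Fin k → Bool) (d : Fin k → ℕ) : ℕ := ∏ i, if p i then rounds (d i) else 1

/-- Bound for the number of steps of the iteration in a box without a large range. -/
def climbs (p : Fin k → Bool) (d : Fin k → ℕ) : ℕ := ∑ i, if p i then min (d i) 7 else 0

/-- Bound for the number of calls of `solve`. -/
def calls (p : Fin k → Bool) (d : Fin k → ℕ) : ℕ :=
  (leaves p d - 1) * (14 * k + 2) + 1 + climbs p d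

theorem leaves_pos (p : Fin k → Bool) (d : Fin k → ℕ) : 1 ≤ leaves p d :=
  Finset.one_le_prod' fun i _ => by split_ifs <;> simp [rounds_pos]

theorem leaves_mono (p : Fin k → Bool) {d e : Fin k → ℕ} (h : d ≤ e) :
    leaves p d ≤ leaves p e :=
  Finset.prod_le_prod' fun i _ => by
    split_ifs
    · exact rounds_mono (h i)
    · exact le_rfl

theorem climbs_le (p : Fin k → Bool) (d : Fin k → ℕ) : climbs p d ≤ 7 * k := by
  refine (Finset.sum_le_card_nsmul _ _ 7 fun i _ => ?_).trans (by simp [mul_comm])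
  split_ifs <;> omega

/-- With R the product for d over the coordinates other than j, the slice has at most R leaves
because j is unmarked there, and the half has at most `rounds (e j)` times R. Now apply
`rounds_half`. -/
theorem leaves_slice {p q : Fin k → Bool} {d d' e : Fin k → ℕ} {j : Fin k} (hj : p j)
    (hdj : 8 ≤ d j) (hq : ∀ i, q i = (p i && !decide (i = j))) (hd : ∀ i ≠ j, d' i ≤ d i)
    (he : e ≤ d) (hej : e j ≤ (d j + 1) / 2) : leaves q d' + leaves p e ≤ leaves p d := by
  have split : ∀ (r : Fin k → Bool) (c : Fin k → ℕ), leaves r c =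
      (if r j then rounds (c j) else 1) *
        ∏ i ∈ Finset.univ.erase j, if r i then rounds (c i) else 1 := fun r c =>
    (Finset.mul_prod_erase _ _ (Finset.mem_univ j)).symm
  rw [split q, split p e, split p d, if_pos hj, if_pos hj, if_neg (by simp [hq])]
  have h₁ : (∏ i ∈ Finset.univ.erase j, if q i then rounds (d' i) else 1) ≤
      ∏ i ∈ Finset.univ.erase j, if p i then rounds (d i) else 1 :=
    Finset.prod_le_prod' fun i hi => by
      have hi := Finset.ne_of_mem_erase hi
      simp only [hq, hi, decide_false, Bool.not_false, Bool.and_true]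
      split_ifs
      · exact rounds_mono (hd i hi)
      · exact le_rfl
  have h₂ : (∏ i ∈ Finset.univ.erase j, if p i then rounds (e i) else 1) ≤
      ∏ i ∈ Finset.univ.erase j, if p i then rounds (d i) else 1 :=
    Finset.prod_le_prod' fun i hi => by
      split_ifs
      · exact rounds_mono (he i)
      · exact le_rfl
  calc _ ≤ 1 * (∏ i ∈ Finset.univ.erase j, if p i then rounds (d i) else 1) + rounds (e j) *
        ∏ i ∈ Finset.univ.erase j, if p i then rounds (d i) else 1 := by gcongr
    _ = (rounds (e j) + 1) * _ := by rw [← add_mul, add_comm]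
    _ ≤ _ := Nat.mul_le_mul_right _ (rounds_half hdj hej)

/-- The weight 14k + 2 of a leaf is what this step consumes: climbing budgets of at most 7k for the
slice and for the half, and two further calls. -/
theorem calls_slice {p q : Fin k → Bool} {d d' e : Fin k → ℕ} {j : Fin k} (hj : p j)
    (hdj : 8 ≤ d j) (hq : ∀ i, q i = (p i && !decide (i = j))) (hd : ∀ i ≠ j, d' i ≤ d i)
    (he : e ≤ d) (hej : e j ≤ (d j + 1) / 2) : calls q d' + calls p e + 1 ≤ calls p d := by
  have h := leaves_slice hj hdj hq hd he hej
  obtain ⟨a, ha⟩ := Nat.exists_eq_add_of_le (leaves_pos q d')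
  obtain ⟨c, hc⟩ := Nat.exists_eq_add_of_le (leaves_pos p e)
  have h₁ := climbs_le q d'
  have h₂ := climbs_le p e
  have h₃ : (a + c + 1) * (14 * k + 2) ≤ (leaves p d - 1) * (14 * k + 2) :=
    Nat.mul_le_mul_right _ (by omega)
  simp only [calls, ha, hc, Nat.add_sub_cancel_left]
  rw [add_mul, add_mul] at h₃
  omega

/-- With all marked ranges below 8 the cap 7 in `climbs` is inactive, so a shrinking range lowers
the sum; elsewhere the cap keeps the sum at most 7k. -/
theorem calls_climb {p : Fin k → Bool} {d e : Fin k → ℕ} {j : Fin k} (hj : p j)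
    (hd : ∀ i, p i → d i < 8) (he : e ≤ d) (hej : e j < d j) : calls p e + 1 ≤ calls p d := by
  have h₁ : (leaves p e - 1) * (14 * k + 2) ≤ (leaves p d - 1) * (14 * k + 2) :=
    Nat.mul_le_mul_right _ (Nat.sub_le_sub_right (leaves_mono p he) 1)
  have h₂ : climbs p e < climbs p d := by
    refine Finset.sum_lt_sum (fun i _ => ?_) ⟨j, Finset.mem_univ j, ?_⟩
    · have : e i ≤ d i := he i
      split_ifs <;> omega
    · have := hd j hj
      simp only [hj, if_true]; omega
  unfold calls
  omega

theorem one_le_calls (p : Fin k → Bool) (d : Fin k → ℕ) : 1 ≤ calls p d := by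
  unfold calls; omega

end Potential

/-! ### The main loop -/

section Solve

variable {k : ℕ} {N : Fin k → ℕ}

theorem lt_two_pow_bitLength (x : Grid N) (i : Fin k) : x.1 i < 2 ^ bitLength N :=
  ((x.2 i).2.trans (Finset.le_sup (Finset.mem_univ i))).trans_lt (Nat.lt_size_self _)

/-- The code of a grid point. -/
abbrev code (x : Grid N) : SExp := ptCode (bitLength N) x.1

/-- A correct answer for a box: a violation of monotonicity, or a point of the box that is fixed
in the marked components. -/
def Solves (f : Grid N → Grid N) (m : SExp) (lo hi : Grid N) (r : SExp) : Prop :=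
  (∃ x y : Grid N, x ≤ y ∧ ¬ f x ≤ f y ∧ r = .cons tru (.cons (code x) (code y))) ∨
  ∃ x : Grid N, lo ≤ x ∧ x ≤ hi ∧ (∀ i : Fin k, m.flag i → (f x).1 i = x.1 i) ∧
    r = .cons .nil (code x)

/-- The point that agrees with `y` in the marked components and with `x` in the others. -/
def mix (m : SExp) (x y : Grid N) : Grid N :=
  ⟨fun i => if m.flag i then y.1 i else x.1 i, fun i => by
    show 1 ≤ ite _ _ _ ∧ ite _ _ _ ≤ _
    split_ifs
    exacts [y.2 i, x.2 i]⟩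

theorem mix_apply (m : SExp) (x y : Grid N) (i : Fin k) :
    (mix m x y).1 i = if m.flag i then y.1 i else x.1 i := rfl

/-- The midpoint of two points. -/
def midpoint (x y : Grid N) : Grid N :=
  ⟨fun i => (x.1 i + y.1 i) / 2, fun i => by
    have := x.2 i
    have := y.2 i
    show 1 ≤ _ / 2 ∧ _ / 2 ≤ _
    omega⟩

theorem midpoint_apply (x y : Grid N) (i : Fin k) :
    (midpoint x y).1 i = (x.1 i + y.1 i) / 2 := rfl

variable {S : ℕ}

theorem size_code_le (hS : k * (2 * bitLength N + 1) ≤ S) (x : Grid N) : (code x).size ≤ S := (size_ptCode_le _).trans hS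

open Classical in
theorem fn_leAll_of_le (hS : k * (2 * bitLength N + 1) ≤ S) {x y : Grid N} (h : x ≤ y) :
    Fn Prog.leAllId (.cons (code x) (code y)) tru (100 * S + 40) := by
  have := fn_leAll (code x) (code y)
  rw [leAll_ptCode (lt_two_pow_bitLength x) (lt_two_pow_bitLength y), decide_eq_true (show x.1 ≤ y.1 from h)] at this
  have hx := size_code_le hS x
  exact this.mono (by omega)

open Classical in
theorem fn_leAll_of_not_le (hS : k * (2 * bitLength N + 1) ≤ S) {x y : Grid N} (h : ¬ x ≤ y) :
    Fn Prog.leAllId (.cons (code x) (code y)) .nil (100 * S + 40) := by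
  have := fn_leAll (code x) (code y)
  rw [leAll_ptCode (lt_two_pow_bitLength x) (lt_two_pow_bitLength y), decide_eq_false (show ¬ x.1 ≤ y.1 from h)] at this
  have hx := size_code_le hS x
  exact this.mono (by omega)

theorem fn_sel_code (hS : k * (2 * bitLength N + 1) ≤ S) (m : SExp) (x y : Grid N) :
    Fn Prog.selId (.cons m (.cons (code x) (code y))) (code (mix m x y)) (50 * S + 40) := by
  have := fn_sel m (code x) (code y)
  rw [sel_ptCode] at this
  have hx := size_code_le hS x
  exact this.mono (by omega)

theorem fn_avgAll_code (hS : k * (2 * bitLength N + 1) ≤ S) (x y : Grid N) :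
    Fn Prog.avgAllId (.cons (code x) (code y)) (code (midpoint x y)) (100 * S + 40) := by
  have := fn_avgAll (code x) (code y)
  rw [avgAll_ptCode (lt_two_pow_bitLength x) (lt_two_pow_bitLength y)] at this
  have hx := size_code_le hS x
  exact this.mono (by omega)

/-- Bound for the time of one call of `solve` without the recursive calls. -/
def stepTime (S : ℕ) : ℕ := 400 * S * S + 8000 * S + 8000

/-- The parenthesis is the cost of one circuit evaluation, of which a call makes at most five; the
rest pays for the other helpers. -/
theorem stepTime_eq : stepTime S = 5 * (80 * S * S + 1000 * S + 300) + 3000 * S + 6500 := by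
  unfold stepTime; ring

/-- The range of the coordinates of a box. -/
def range (lo hi : Grid N) (i : Fin k) : ℕ := hi.1 i - lo.1 i

/-- Induction on the sum of all ranges: climbing raises a coordinate of lo, a slice collapses range
j to zero, and keeping a half shrinks range j. -/
theorem fn_solve (hS : k * (2 * bitLength N + 1) ≤ S) {f : Grid N → Grid N}
    {C : Circuit (k * bitLength N) (k * bitLength N)} (hC : C.Presents f)
    (hCS : (encodeCircuit C).size ≤ S) {m : SExp} (hm : m.size ≤ S) {lo hi : Grid N}
    (hlh : lo ≤ hi) (hlo : ∀ i : Fin k, m.flag i → lo.1 i ≤ (f lo).1 i)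
    (hhi : ∀ i : Fin k, m.flag i → (f hi).1 i ≤ hi.1 i) :
    ∃ r, Solves f m lo hi r ∧
      Fn Prog.solveId (.cons (encodeCircuit C) (.cons m (.cons (code lo) (code hi)))) r
        (stepTime S * calls (fun i : Fin k => m.flag i) (range lo hi)) := by
  induction hn : ∑ i, range lo hi i using Nat.strong_induction_on generalizing m lo hi with
  | _ n ih =>
  subst hn
  have hD := stepTime_eq (S := S)
  generalize stepTime S = D at hD ih ⊢
  -- This pays for the branches of the small-box case that stop without a recursive call, and for
  -- failed tests before the slice is solved.
  have hV := Nat.mul_le_mul_left D (one_le_calls (fun i : Fin k => m.flag i) (range lo hi))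
  have hev : ∀ x : Grid N, Fn Prog.evalId (.cons (encodeCircuit C) (code x)) (code (f x))
      (80 * S * S + 1000 * S + 300) := fun x => by
    have := fn_eval _ _ hCS (size_code_le hS x)
    rwa [evalAt_encodeCircuit hC] at this
  generalize 80 * S * S + 1000 * S + 300 = E at hev hD
  have hpick := (fn_pick m (code lo) (code hi)).mono (t := 400 * S + 40) (by
    have := size_code_le hS lo
    omega)
  rcases pick_ptCode m (x := lo.1) (y := hi.1) hlh (lt_two_pow_bitLength hi) with
    ⟨hp, hsmall⟩ | ⟨a, d, j, hp, hmj, hbig, hd⟩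
  · rw [hp] at hpick
    -- By the invariant the new point is never below lo, so the one-sided test detects equality.
    have hlog : ∀ i, (mix m lo (f lo)).1 i ≤ lo.1 i → (mix m lo (f lo)).1 i = lo.1 i := by
      intro i h
      rw [mix_apply] at h ⊢
      split_ifs at h ⊢ with hi
      · exact le_antisymm h (hlo i hi)
      · rfl
    have hly : lo ≤ mix m lo (f lo) := fun i => by
      show _ ≤ (mix m lo (f lo)).1 i
      rw [mix_apply]
      split_ifs with hi
      exacts [hlo i hi, le_rfl]
    have hsel := fn_sel_code hS m lo (f lo)
    have hmix := mix_apply m lo (f lo)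
    generalize mix m lo (f lo) = y at hlog hly hsel hmix
    by_cases h₁ : y ≤ lo
    · refine ⟨_, .inr ⟨lo, le_rfl, hlh, fun i hi => ?_, rfl⟩, Fn.of_body Prog.solve rfl ?_⟩
      · rw [← hlog i (h₁ i), hmix, if_pos hi]
      · simp only [Prog.solve, Prog.climb, wp, List.getD_cons_zero, List.getD_cons_succ,
          head_cons, tail_cons]
        exact CallSpec.intro hpick (CallSpec.intro (hev _) (CallSpec.intro hsel
          (CallSpec.intro (fn_leAll_of_le hS h₁) ⟨trivial, by omega⟩)))
    by_cases h₂ : f lo ≤ f hi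
    swap
    · refine ⟨_, .inl ⟨lo, hi, hlh, h₂, rfl⟩, Fn.of_body Prog.solve rfl ?_⟩
      simp only [Prog.solve, Prog.climb, wp, List.getD_cons_zero, List.getD_cons_succ,
        head_cons, tail_cons]
      exact CallSpec.intro hpick (CallSpec.intro (hev _) (CallSpec.intro hsel
        (CallSpec.intro (fn_leAll_of_not_le hS h₁) (CallSpec.intro (hev _)
          (CallSpec.intro (fn_leAll_of_not_le hS h₂) ⟨trivial, by omega⟩)))))
    by_cases h₃ : f lo ≤ f y
    swap
    · refine ⟨_, .inl ⟨lo, y, hly, h₃, rfl⟩, Fn.of_body Prog.solve rfl ?_⟩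
      simp only [Prog.solve, Prog.climb, wp, List.getD_cons_zero, List.getD_cons_succ,
        head_cons, tail_cons]
      exact CallSpec.intro hpick (CallSpec.intro (hev _) (CallSpec.intro hsel
        (CallSpec.intro (fn_leAll_of_not_le hS h₁) (CallSpec.intro (hev _)
          (CallSpec.intro (fn_leAll_of_le hS h₂) (CallSpec.intro (hev _)
            (CallSpec.intro (fn_leAll_of_not_le hS h₃) ⟨rfl, by omega⟩)))))))
    -- In a marked coordinate y = f(lo) ≤ f(hi) ≤ hi, by the test at hi and the invariant.
    have hyh : y ≤ hi := fun i => by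
      show y.1 i ≤ hi.1 i
      rw [hmix]
      split_ifs with hi'
      exacts [(h₂ i).trans (hhi i hi'), hlh i]
    obtain ⟨j, hj⟩ : ∃ j, lo.1 j < y.1 j := by
      by_contra! h
      exact h₁ h
    have hmj : m.flag j = true := by
      by_contra h
      rw [hmix, if_neg h] at hj
      exact hj.false
    have hrange : range y hi ≤ range lo hi := fun i => Nat.sub_le_sub_left (hly i) _
    have hrangej : range y hi j < range lo hi j := by
      have : y.1 j ≤ hi.1 j := hyh j
      unfold range; omega
    -- The test f(lo) ≤ f(y) renews the invariant at y, because y = f(lo) in the marked coordinates.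
    obtain ⟨r, hr, hfn⟩ := ih _ (Finset.sum_lt_sum (fun i _ => hrange i)
      ⟨j, Finset.mem_univ j, hrangej⟩) hm hyh (fun i hi => by
        have := h₃ i
        rw [hmix, if_pos hi]
        exact this) hhi rfl
    have hcalls : D * (calls (fun i : Fin k => m.flag i) (range y hi) + 1) ≤
        D * calls (fun i : Fin k => m.flag i) (range lo hi) :=
      Nat.mul_le_mul_left D (calls_climb hmj hsmall hrange hrangej)
    refine ⟨r, ?_, Fn.of_body Prog.solve rfl ?_⟩
    · rcases hr with hr | ⟨x, h, h', hr⟩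
      · exact .inl hr
      · exact .inr ⟨x, hly.trans h, h', hr⟩
    · rw [mul_add] at hcalls
      simp only [Prog.solve, Prog.climb, wp, List.getD_cons_zero, List.getD_cons_succ,
        head_cons, tail_cons]
      exact CallSpec.intro hpick (CallSpec.intro (hev _) (CallSpec.intro hsel
        (CallSpec.intro (fn_leAll_of_not_le hS h₁) (CallSpec.intro (hev _)
          (CallSpec.intro (fn_leAll_of_le hS h₂) (CallSpec.intro (hev _)
            (CallSpec.intro (fn_leAll_of_le hS h₃) (CallSpec.intro hfn ⟨rfl, by omega⟩))))))))
  · rw [hp] at hpick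
    generalize hδ : SExp.cons a d = δ at hd
    have hmid := fn_avgAll_code hS lo hi
    have hlo' := fn_sel_code hS δ lo (midpoint lo hi)
    have hhi' := fn_sel_code hS δ hi (midpoint lo hi)
    have hmask := (fn_sel δ m .nil).mono (t := 50 * S + 40) (by omega)
    have hll : lo ≤ mix δ lo (midpoint lo hi) := fun i => by
      have : lo.1 i ≤ hi.1 i := hlh i
      show lo.1 i ≤ (mix δ lo (midpoint lo hi)).1 i
      rw [mix_apply, midpoint_apply]
      split_ifs <;> omega
    have hhh : mix δ hi (midpoint lo hi) ≤ hi := fun i => by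
      have : lo.1 i ≤ hi.1 i := hlh i
      show (mix δ hi (midpoint lo hi)).1 i ≤ hi.1 i
      rw [mix_apply, midpoint_apply]
      split_ifs <;> omega
    have hlh' : mix δ lo (midpoint lo hi) ≤ mix δ hi (midpoint lo hi) := fun i => by
      have : lo.1 i ≤ hi.1 i := hlh i
      show (if _ then _ else _) ≤ if _ then _ else _
      split_ifs
      exacts [le_rfl, this]
    have hlj : (mix δ lo (midpoint lo hi)).1 j = (lo.1 j + hi.1 j) / 2 := by
      rw [mix_apply, hd, decide_eq_true rfl, if_pos rfl]; rfl
    have hhj : (mix δ hi (midpoint lo hi)).1 j = (lo.1 j + hi.1 j) / 2 := by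
      rw [mix_apply, hd, decide_eq_true rfl, if_pos rfl]; rfl
    have hli : ∀ i ≠ j, (mix δ lo (midpoint lo hi)).1 i = lo.1 i := fun i hi => by
      rw [mix_apply, hd, decide_eq_false hi, if_neg (by simp)]
    have hhi'' : ∀ i ≠ j, (mix δ hi (midpoint lo hi)).1 i = hi.1 i := fun i hi => by
      rw [mix_apply, hd, decide_eq_false hi, if_neg (by simp)]
    generalize mix δ lo (midpoint lo hi) = lo' at *
    generalize mix δ hi (midpoint lo hi) = hi' at *
    have hq : ∀ i : Fin k, (sel δ m .nil).flag i = (m.flag i && !decide (i = j)) := fun i => by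
      rw [flag_sel, hd]
    -- This test carries the lower invariant to the slice: for marked i ≠ j, lo' = lo ≤ f(lo) ≤
    -- f(lo') in coordinate i. The next test does the same for the upper corner.
    by_cases h₁ : f lo ≤ f lo'
    swap
    · refine ⟨_, .inl ⟨lo, lo', hll, h₁, rfl⟩, Fn.of_body Prog.solve rfl ?_⟩
      simp only [Prog.solve, Prog.slice, wp, List.getD_cons_zero, List.getD_cons_succ,
        head_cons, tail_cons]
      refine CallSpec.intro hpick ?_
      simp only [hδ]
      exact (CallSpec.intro hmid (CallSpec.intro hlo' (CallSpec.intro hhi'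
        (CallSpec.intro (hev _) (CallSpec.intro (hev _)
        (CallSpec.intro (fn_leAll_of_not_le hS h₁) ⟨rfl, by omega⟩))))))
    by_cases h₂ : f hi' ≤ f hi
    swap
    · refine ⟨_, .inl ⟨hi', hi, hhh, h₂, rfl⟩, Fn.of_body Prog.solve rfl ?_⟩
      simp only [Prog.solve, Prog.slice, wp, List.getD_cons_zero, List.getD_cons_succ,
        head_cons, tail_cons]
      refine CallSpec.intro hpick ?_
      simp only [hδ]
      exact (CallSpec.intro hmid (CallSpec.intro hlo' (CallSpec.intro hhi'
        (CallSpec.intro (hev _) (CallSpec.intro (hev _)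
        (CallSpec.intro (fn_leAll_of_le hS h₁) (CallSpec.intro (hev _) (CallSpec.intro (hev _)
        (CallSpec.intro (fn_leAll_of_not_le hS h₂) ⟨rfl, by omega⟩)))))))))
    have hsub : ∀ i, range lo' hi' i ≤ range lo hi i := fun i =>
      tsub_le_tsub (hhh i) (hll i)
    have hsubj : range lo' hi' j = 0 := by rw [range, hlj, hhj, Nat.sub_self]
    have hflag : ∀ i : Fin k, (sel δ m .nil).flag i → m.flag i ∧ i ≠ j := fun i hi => by
      simpa [hq] using hi
    obtain ⟨r, hr, hfn⟩ := ih _ (Finset.sum_lt_sum (fun i _ => hsub i)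
      ⟨j, Finset.mem_univ j, by rw [hsubj]; unfold range; omega⟩)
      ((size_sel_le δ m).trans hm) hlh'
      (fun i hi => by
        obtain ⟨hi, hij⟩ := hflag i hi
        rw [hli i hij]
        exact (hlo i hi).trans (h₁ i))
      (fun i hi => by
        obtain ⟨hi, hij⟩ := hflag i hi
        rw [hhi'' i hij]
        exact (h₂ i).trans (hhi i hi)) rfl
    -- Here e stands for whichever half is kept: its calls, those of the slice and the present one
    -- fit the budget.
    have key : ∀ e : Fin k → ℕ, e ≤ range lo hi → e j ≤ (range lo hi j + 1) / 2 →
        D * calls (fun i : Fin k => (sel δ m .nil).flag i) (range lo' hi') +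
          D * calls (fun i : Fin k => m.flag i) e + D ≤
          D * calls (fun i : Fin k => m.flag i) (range lo hi) := fun e he hej => by
      have := Nat.mul_le_mul_left D (calls_slice (j := j) hmj hbig hq (fun i _ => hsub i) he hej)
      rwa [mul_add, mul_add, mul_one] at this
    rcases hr with hr | ⟨x, hlx, hxh, hx, rfl⟩
    · refine ⟨r, .inl hr, Fn.of_body Prog.solve rfl ?_⟩
      obtain ⟨_, _, _, _, rfl⟩ := hr
      -- No half is searched after a violation, so any admissible e will do.
      have := key (fun _ => 0) (fun _ => Nat.zero_le _) (Nat.zero_le _)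
      simp only [Prog.solve, Prog.slice, Prog.descend, wp, List.getD_cons_zero,
        List.getD_cons_succ, head_cons, tail_cons]
      refine CallSpec.intro hpick ?_
      simp only [hδ]
      exact (CallSpec.intro hmid (CallSpec.intro hlo' (CallSpec.intro hhi'
        (CallSpec.intro (hev _) (CallSpec.intro (hev _)
        (CallSpec.intro (fn_leAll_of_le hS h₁) (CallSpec.intro (hev _) (CallSpec.intro (hev _)
        (CallSpec.intro (fn_leAll_of_le hS h₂) (CallSpec.intro hmask (CallSpec.intro hfn
        ⟨rfl, by omega⟩)))))))))))
    have hlx' : lo ≤ x := hll.trans hlx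
    have hxh' : x ≤ hi := hxh.trans hhh
    have hxj : x.1 j = (lo.1 j + hi.1 j) / 2 := by
      have h₁ : lo'.1 j ≤ x.1 j := hlx j
      have h₂ : x.1 j ≤ hi'.1 j := hxh j
      omega
    have hcmp := fn_sel_code hS δ x (f x)
    -- The two points differ at most in coordinate j, so the comparison of points tests that
    -- coordinate alone.
    have hup : x ≤ mix δ x (f x) ↔ x.1 j ≤ (f x).1 j := by
      constructor
      · intro h
        have : x.1 j ≤ (mix δ x (f x)).1 j := h j
        rwa [mix_apply, hd, decide_eq_true rfl, if_pos rfl] at this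
      · intro h i
        show x.1 i ≤ (mix δ x (f x)).1 i
        rw [mix_apply, hd]
        by_cases hij : i = j
        · subst hij; simpa using h
        · simp [hij]
    have hxm : ∀ i : Fin k, m.flag i → i ≠ j → (f x).1 i = x.1 i := fun i hi hij =>
      hx i (by rw [hq, hi]; simp [hij])
    by_cases h₃ : x ≤ mix δ x (f x)
    · have hrange : range x hi ≤ range lo hi := fun i => Nat.sub_le_sub_left (hlx' i) _
      -- The midpoint is rounded down, so the upper half is the longer one when the range is odd.
      have hrangej : range x hi j ≤ (range lo hi j + 1) / 2 := by
        unfold range; omega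
      obtain ⟨r, hr, hfn'⟩ := ih _ (Finset.sum_lt_sum (fun i _ => hrange i)
        ⟨j, Finset.mem_univ j, by unfold range at *; omega⟩) hm hxh' (fun i hi => by
          by_cases hij : i = j
          · subst hij; exact hup.1 h₃
          · exact (hxm i hi hij).ge) hhi rfl
      have := key _ hrange hrangej
      refine ⟨r, ?_, Fn.of_body Prog.solve rfl ?_⟩
      · rcases hr with hr | ⟨z, h, h', hr⟩
        · exact .inl hr
        · exact .inr ⟨z, hlx'.trans h, h', hr⟩
      · simp only [Prog.solve, Prog.slice, Prog.descend, wp, List.getD_cons_zero,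
          List.getD_cons_succ, head_cons, tail_cons]
        refine CallSpec.intro hpick ?_
        simp only [hδ]
        exact (CallSpec.intro hmid (CallSpec.intro hlo' (CallSpec.intro hhi'
          (CallSpec.intro (hev _) (CallSpec.intro (hev _)
          (CallSpec.intro (fn_leAll_of_le hS h₁) (CallSpec.intro (hev _) (CallSpec.intro (hev _)
          (CallSpec.intro (fn_leAll_of_le hS h₂) (CallSpec.intro hmask (CallSpec.intro hfn
          (CallSpec.intro (hev _) (CallSpec.intro hcmp
          (CallSpec.intro (fn_leAll_of_le hS h₃) (CallSpec.intro hfn' ⟨rfl, by omega⟩)))))))))))))))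
    · have hrange : range lo x ≤ range lo hi := fun i => Nat.sub_le_sub_right (hxh' i) _
      have hrangej : range lo x j ≤ (range lo hi j + 1) / 2 := by
        unfold range; omega
      obtain ⟨r, hr, hfn'⟩ := ih _ (Finset.sum_lt_sum (fun i _ => hrange i)
        ⟨j, Finset.mem_univ j, by unfold range at *; omega⟩) hm hlx' hlo (fun i hi => by
          by_cases hij : i = j
          · subst hij; exact (not_le.1 fun h => h₃ (hup.2 h)).le
          · exact (hxm i hi hij).le) rfl
      have := key _ hrange hrangej
      refine ⟨r, ?_, Fn.of_body Prog.solve rfl ?_⟩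
      · rcases hr with hr | ⟨z, h, h', hr⟩
        · exact .inl hr
        · exact .inr ⟨z, h, h'.trans hxh', hr⟩
      · simp only [Prog.solve, Prog.slice, Prog.descend, wp, List.getD_cons_zero,
          List.getD_cons_succ, head_cons, tail_cons]
        refine CallSpec.intro hpick ?_
        simp only [hδ]
        exact (CallSpec.intro hmid (CallSpec.intro hlo' (CallSpec.intro hhi'
          (CallSpec.intro (hev _) (CallSpec.intro (hev _)
          (CallSpec.intro (fn_leAll_of_le hS h₁) (CallSpec.intro (hev _) (CallSpec.intro (hev _)
          (CallSpec.intro (fn_leAll_of_le hS h₂) (CallSpec.intro hmask (CallSpec.intro hfn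
          (CallSpec.intro (hev _) (CallSpec.intro hcmp
          (CallSpec.intro (fn_leAll_of_not_le hS h₃)
          (CallSpec.intro hfn' ⟨rfl, by omega⟩)))))))))))))))

end Solve

/-! ### Running the algorithm on the whole grid -/

section Main

variable {k : ℕ} {N : Fin k → ℕ}

/-- A coordinate with at least one bit is a nonempty list and so counts as a mark; this is why the
upper corner can double as the full initial mask. -/
theorem flag_ptCode {b : ℕ} (x : Fin k → ℕ) (i : Fin k) : (ptCode (b + 1) x).flag i = true := by
  induction k with
  | zero => exact i.elim0
  | succ k ih =>
    rw [ptCode_succ]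
    induction i using Fin.cases with
    | zero => rw [bitsCode_succ]; rfl
    | succ i => exact ih _ i

/-- The size of the data that the algorithm handles, for a circuit with `c` gates. -/
def dataSize (k b c : ℕ) : ℕ :=
  (c + k * b) * (2 * (k * b + c) + 6) + 1 + k * (2 * b + 1)

theorem exists_answer (hN : ∀ i, 1 ≤ N i) {f : Grid N → Grid N}
    {C : Circuit (k * bitLength N) (k * bitLength N)} (hw : 2 ≤ width N) (hC : C.Presents f) :
    ∃ S : Answer (Grid N), S.IsSolution f ∧
      EvalLE prog [encodeInput N C] (prog.getD 0 .nil) (encodeAnswer S)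
        (stepTime (dataSize k (bitLength N) C.size) * (rounds (width N - 1) ^ k * (14 * k + 2)) +
          100 * dataSize k (bitLength N) C.size + 200) := by
  obtain ⟨b, hb⟩ : ∃ b, bitLength N = b + 1 :=
    Nat.exists_eq_succ_of_ne_zero (Nat.size_pos.2 (by omega)).ne'
  have hS : k * (2 * bitLength N + 1) ≤ dataSize k (bitLength N) C.size := by
    unfold dataSize; omega
  have hCS : (encodeCircuit C).size ≤ dataSize k (bitLength N) C.size := by
    have := size_encodeCircuit_le C
    unfold dataSize; omega
  generalize dataSize k (bitLength N) C.size = S at hS hCS ⊢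
  let hi : Grid N := ⟨N, fun i => ⟨hN i, le_rfl⟩⟩
  let lo : Grid N := ⟨fun _ => 1, fun i => ⟨le_rfl, hN i⟩⟩
  have hones : Fn Prog.onesId (code hi) (code lo) (100 * S + 40) := by
    have := fn_ones (code hi)
    have hsize := size_code_le hS hi
    simp only [code] at this hsize ⊢
    rw [hb] at this hsize ⊢
    rw [ones_ptCode] at this
    exact this.mono (by omega)
  have hflag : ∀ i : Fin k, (code hi).flag i = true := fun i => by
    rw [code, hb]; exact flag_ptCode _ i
  obtain ⟨r, hr, hfn⟩ := fn_solve hS hC hCS (size_code_le hS hi) (lo := lo) (hi := hi)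
    (fun i => hN i) (fun i _ => ((f lo).2 i).1) (fun i _ => ((f hi).2 i).2)
  have hcalls : calls (fun i : Fin k => (code hi).flag i) (range lo hi) ≤
      rounds (width N - 1) ^ k * (14 * k + 2) := by
    have h₁ : leaves (fun i : Fin k => (code hi).flag i) (range lo hi) ≤
        rounds (width N - 1) ^ k := by
      refine (Finset.prod_le_pow_card _ _ (rounds (width N - 1)) fun i _ => ?_).trans (by simp)
      rw [if_pos (hflag i)]
      exact rounds_mono (Nat.sub_le_sub_right (Finset.le_sup (f := N) (Finset.mem_univ i)) 1)
    -- The weight 14k + 2 of the one leaf subtracted in `calls` covers the remaining 1 + 7k.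
    refine le_trans ?_ (Nat.mul_le_mul_right _ h₁)
    obtain ⟨a, ha⟩ := Nat.exists_eq_add_of_le
      (leaves_pos (fun i : Fin k => (code hi).flag i) (range lo hi))
    have h₂ := climbs_le (fun i : Fin k => (code hi).flag i) (range lo hi)
    rw [calls, ha, Nat.add_sub_cancel_left, add_mul]
    omega
  have hmain : EvalLE prog [encodeInput N C] (prog.getD 0 .nil) r
      (stepTime S * (rounds (width N - 1) ^ k * (14 * k + 2)) + 100 * S + 200) := by
    have hmul := Nat.mul_le_mul_left (stepTime S) hcalls
    refine Fn.of_body Prog.main rfl ?_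
    simp only [Prog.main, wp, List.getD_cons_zero, encodeInput, head_cons, tail_cons]
    exact .intro hones (.intro hfn ⟨rfl, by omega⟩)
  rcases hr with ⟨x, y, hxy, hf, rfl⟩ | ⟨x, _, _, hx, rfl⟩
  · exact ⟨.violation x y, ⟨hxy, hf⟩, hmain⟩
  · exact ⟨.fixedPoint x, Subtype.ext (funext fun i => hx i (hflag i)), hmain⟩

end Main

/-! ### The time bound as a polynomial -/

/-- A bound for the number of gates plus the number of outputs. -/
noncomputable def wirePoly (p : MvPolynomial (Fin 2) ℝ) : MvPolynomial (Fin 2) ℝ :=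
  p + .X 1 * (.X 0 + 1)

/-- A bound for `dataSize`. -/
noncomputable def dataPoly (p : MvPolynomial (Fin 2) ℝ) : MvPolynomial (Fin 2) ℝ :=
  wirePoly p * (2 * wirePoly p + 6) + 1 + .X 1 * (2 * (.X 0 + 1) + 1)

/-- The polynomial factor of the time bound. -/
noncomputable def timePoly (p : MvPolynomial (Fin 2) ℝ) : MvPolynomial (Fin 2) ℝ :=
  .X 0 * ((400 * dataPoly p * dataPoly p + 8000 * dataPoly p + 8000) * (14 * .X 1 + 2) +
    100 * dataPoly p + 200)

/-- As `rounds (n - 1)` is at most log n, its k-th power is at most (log n)^k, and one factor moves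
into the polynomial. The bit length may exceed log n by one, as it enters only polynomially. -/
theorem time_le_timePoly {k b c n : ℕ} (hk : 1 ≤ k) (hn : 2 ≤ n) (hb : b = Nat.size n)
    {p : MvPolynomial (Fin 2) ℝ}
    (hc : (c : ℝ) ≤ MvPolynomial.eval ![Real.logb 2 n, (k : ℝ)] p) :
    ((stepTime (dataSize k b c) * (rounds (n - 1) ^ k * (14 * k + 2)) +
      100 * dataSize k b c + 200 : ℕ) : ℝ) ≤
      MvPolynomial.eval ![Real.logb 2 n, (k : ℝ)] (timePoly p) * Real.logb 2 n ^ (k - 1) := by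
  have hlog : (Nat.log 2 n : ℝ) ≤ Real.logb 2 n := by
    exact_mod_cast Real.natLog_le_logb n 2
  have hone : 1 ≤ Nat.log 2 n := Nat.le_log_of_pow_le (by norm_num) (by simpa using hn)
  have hX : 1 ≤ Real.logb 2 n := le_trans (by exact_mod_cast hone) hlog
  have hbX : (b : ℝ) ≤ Real.logb 2 n + 1 := by
    have : b ≤ Nat.log 2 n + 1 := by
      rw [hb, Nat.size_le]
      exact Nat.lt_pow_succ_log_self (by norm_num) n
    have : (b : ℝ) ≤ Nat.log 2 n + 1 := by exact_mod_cast this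
    linarith
  have hround : (rounds (n - 1) : ℝ) ≤ Real.logb 2 n := by
    refine le_trans ?_ hlog
    have : rounds (n - 1) ≤ Nat.log 2 n := max_le hone (Nat.log_mono_right (by omega))
    exact_mod_cast this
  have hwire : (c + k * b : ℝ) ≤ MvPolynomial.eval ![Real.logb 2 n, (k : ℝ)] (wirePoly p) := by
    simp only [wirePoly, map_add, map_mul, MvPolynomial.eval_X, map_one, Matrix.cons_val_zero,
      Matrix.cons_val_one]
    gcongr
  have hdata : (dataSize k b c : ℝ) ≤
      MvPolynomial.eval ![Real.logb 2 n, (k : ℝ)] (dataPoly p) := by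
    simp only [dataPoly, map_add, map_mul, MvPolynomial.eval_X, map_one, map_ofNat,
      Matrix.cons_val_zero, Matrix.cons_val_one]
    have hpos : (0 : ℝ) ≤ c + k * b := by positivity
    -- The coefficients of p may be negative; nonnegativity of the value comes from the natural
    -- number it bounds.
    have hpos' := hpos.trans hwire
    calc (dataSize k b c : ℝ) = (c + k * b) * (2 * (c + k * b) + 6) + 1 + k * (2 * b + 1) := by
          unfold dataSize; push_cast; ring
      _ ≤ _ := by gcongr
  simp only [timePoly, map_add, map_mul, MvPolynomial.eval_X, map_ofNat,
    Matrix.cons_val_zero, Matrix.cons_val_one]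
  generalize MvPolynomial.eval ![Real.logb 2 n, (k : ℝ)] (dataPoly p) = s at hdata ⊢
  generalize Real.logb 2 n = X at *
  have hpow : (rounds (n - 1) : ℝ) ^ k ≤ X ^ k := by gcongr
  have hs : (0 : ℝ) ≤ dataSize k b c := by positivity
  -- Since n ≥ 2 gives log n ≥ 1, the part of the time outside the calls may also be multiplied by
  -- the power.
  have hXk : 1 ≤ X ^ k := one_le_pow₀ hX
  have hs' := hs.trans hdata
  calc ((stepTime (dataSize k b c) * (rounds (n - 1) ^ k * (14 * k + 2)) +
        100 * dataSize k b c + 200 : ℕ) : ℝ)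
      = (400 * dataSize k b c * dataSize k b c + 8000 * dataSize k b c + 8000) *
          (rounds (n - 1) ^ k * (14 * k + 2)) + (100 * dataSize k b c + 200) * 1 := by
        unfold stepTime; push_cast; ring
    _ ≤ (400 * s * s + 8000 * s + 8000) * (X ^ k * (14 * k + 2)) + (100 * s + 200) * X ^ k := by
        gcongr
    _ = X ^ 1 * X ^ (k - 1) * ((400 * s * s + 8000 * s + 8000) * (14 * k + 2) + 100 * s + 200) := by
        rw [← pow_add, Nat.add_sub_cancel' hk]; ring
    _ = _ := by ring

end TarskiTime

theorem mainTheorem6 :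
    ∃ P : Program, ∀ p : MvPolynomial (Fin 2) ℝ, ∃ q : MvPolynomial (Fin 2) ℝ,
      ∀ (k : ℕ) (N : Fin k → ℕ) (f : Grid N → Grid N)
        (C : Circuit (k * bitLength N) (k * bitLength N)),
        3 ≤ k → (∀ i, 1 ≤ N i) → 2 ≤ width N → C.Presents f →
        (C.size : ℝ) ≤ MvPolynomial.eval ![Real.logb 2 (width N), (k : ℝ)] p →
        ∃ (S : Answer (Grid N)) (t : ℕ),
          S.IsSolution f ∧
          P.HaltsIn (encodeInput N C) (encodeAnswer S) t ∧
          (t : ℝ) ≤ MvPolynomial.eval ![Real.logb 2 (width N), (k : ℝ)] q *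
            Real.logb 2 (width N) ^ (k - 1) := by
  refine ⟨prog, fun p => ⟨timePoly p, fun k N f C hk hN hw hC hp => ?_⟩⟩
  obtain ⟨S, hS, t, ht, h⟩ := exists_answer hN hw hC
  exact ⟨S, t, hS, h, (Nat.cast_le.2 ht).trans
    (time_le_timePoly (by omega) hw rfl hp)⟩
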